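/- Let $\kappa,H\in\mathbb{R}$. For real $\kappa_0,\tau_0$, let $\mathbb{E}(\kappa_0,\tau_0)$ denote the simply connected oriented homogeneous $3$-space fibring over the complete simply connected surface $\mathbb{M}^2(\kappa_0)$ of constant curvature $\kappa_0$, with unit Killing field $\xi$ along the fibres and $\overline\nabla_X\xi=\tau_0\,X\times\xi$; in particular $\mathbb{E}(\kappa_0,0)=\mathbb{M}^2(\kappa_0)\times\mathbb{R}$. For an isometric immersion $\phi$ of a Riemannian surface $\Sigma$ with unit normal $N$, the fundamental data $(A,T,J,\nu)$ are $Av=-\overline\nabla_{\mathrm{d}\phi(v)}N$, $\nu=\langle\xi,N\rangle$, $\mathrm{d}\phi(T)=\xi-\nu N$ and $\mathrm{d}\phi(Ju)=N\times\mathrm{d}\phi(u)$. Let $\widetilde\phi:\Sigma\to\mathbb{E}(4H^2+\kappa,H)$ be a minimal isometric immersion with unit normal $\widetilde N$, Killing field $\widetilde\xi$ and fundamental data $(\widetilde A,\widetilde T,J,\nu)$, and let $\phi:\Sigma\to\mathbb{M}^2(\kappa)\times\mathbb{R}$ be a conjugate isometric $H$-immersion with unit normal $N$, that is, one with fundamental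 data $(J\widetilde A+H\,\mathrm{id},\,J\widetilde T,\,J,\,\nu)$. Let $\alpha:[0,\ell]\to\Sigma$, $\ell>0$, be a smooth unit-speed curve such that $\widetilde\gamma=\widetilde\phi\circ\alpha$ is a horizontal geodesic (a geodesic orthogonal to $\widetilde\xi$), and write $\gamma=\phi\circ\alpha=(\beta,z)$ and $\nu=\nu\circ\alpha$ along these curves. Then $\gamma$ is contained in a totally geodesic vertical plane $P$ (the preimage in $\mathbb{M}^2(\kappa)\times\mathbb{R}$ of a complete geodesic of $\mathbb{M}^2(\kappa)$) which $\phi$ meets orthogonally along $\gamma$, and moreover: (a) $|z'|=\sqrt{1-\nu^2}$ and $\|\beta'\|=|\nu|$ on $[0,\ell]$. In particular, $z$ is injective near each $t$ with $\nu(t)\neq\pm1$, and $\beta$ is injective near each $t$ with $\nu(t)\neq 0$. (b) Let $X$ be the field along $\widetilde\gamma$ for which $(\widetilde\gamma',\widetilde\xi,X)$ is a positively oriented orthonormal frame. There is $\theta\in\mathcal{C}^\infty([0,\ell])$ with $\widetilde N=\cos\theta\,X+\sin\theta\,\widetilde\xi$ along $\widetilde\gamma$, and for every such $\theta$ the geodesic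 curvature of $\gamma$ as a curve of $P$, with respect to $N$ as conormal, is $\kappa_g^P=\theta'$. -/

import Mathlib

open Set Topology Bundle
open scoped Manifold ContDiff InnerProductSpace

noncomputable section

/-- A Riemannian manifold presented as a submanifold of a vector space `V`: the set of its points,
its tangent spaces, and a smooth field of symmetric bilinear forms, defined on a neighbourhood of
the set in `V`, whose restriction to the tangent spaces is the Riemannian metric. -/
structure EmbeddedRiemannian (V : Type*) where
  carrier : Set V
  tangent : V → Set V
  metric : V → V → V → ℝ

namespace EmbeddedRiemannian

variable {V : Type*} [NormedAddCommGroup V] [NormedSpace ℝ V]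

/-- The Christoffel form of the first kind,
`½ (∂_u g(v,w) + ∂_v g(u,w) - ∂_w g(u,v))` at `p`. -/
def christoffel (M : EmbeddedRiemannian V) (p u v w : V) : ℝ :=
  (fderiv ℝ (fun x => M.metric x v w) p u + fderiv ℝ (fun x => M.metric x u w) p v
    - fderiv ℝ (fun x => M.metric x u v) p w) / 2

/-- The number `⟨∇_u Y, w⟩` at the point `p` for the Levi-Civita connection of `M`. Here `Y` is (the
value at `p` of) a tangent field of `M` along a map into `M`, `u` is the velocity of that map at `p`,
`dY` is the derivative of `Y`, as a `V`-valued map, in the same direction, and `w` is tangent to `M`.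
(For a submanifold the Koszul formula of the ambient field of forms restricts to tangent `w`.) -/
def covInner (M : EmbeddedRiemannian V) (p u Y dY w : V) : ℝ :=
  M.metric p dY w + M.christoffel p u Y w

/-- The number `⟨∇_{γ'} γ', w⟩` at time `t` for a curve `γ` defined on the set `s` of times. -/
def accelInner (M : EmbeddedRiemannian V) (γ : ℝ → V) (s : Set ℝ) (t : ℝ) (w : V) : ℝ :=
  M.covInner (γ t) (derivWithin γ s t) (derivWithin γ s t)
    (derivWithin (fun r => derivWithin γ s r) s t) w

/-- `γ : s → M` is a geodesic of `M`. -/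
structure IsGeodesicOn (M : EmbeddedRiemannian V) (γ : ℝ → V) (s : Set ℝ) : Prop where
  smooth : ContDiffOn ℝ ∞ γ s
  mem : ∀ t ∈ s, γ t ∈ M.carrier
  accel : ∀ t ∈ s, ∀ w ∈ M.tangent (γ t), M.accelInner γ s t w = 0

/-- `P` is a totally geodesic submanifold of `M`: it is a Riemannian submanifold, and the
acceleration in `M` of every smooth curve contained in `P` has no component normal to `P`. -/
structure IsTotallyGeodesicIn (P M : EmbeddedRiemannian V) : Prop where
  subset : P.carrier ⊆ M.carrier
  tangent_subset : ∀ p ∈ P.carrier, P.tangent p ⊆ M.tangent p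
  metric_eq : ∀ p ∈ P.carrier, ∀ u ∈ P.tangent p, ∀ v ∈ P.tangent p,
    P.metric p u v = M.metric p u v
  accel : ∀ σ : ℝ → V, ContDiff ℝ ∞ σ → (∀ t, σ t ∈ P.carrier) →
    ∀ t, ∀ n ∈ M.tangent (σ t), (∀ w ∈ P.tangent (σ t), M.metric (σ t) n w = 0) →
      M.accelInner σ univ t n = 0

end EmbeddedRiemannian

/-- The complete simply connected surface `𝕄²(κ)` of constant curvature `κ`, as the component through
the origin of the quadric `x² + y² + κ s² = 2 s` of `ℝ³` with the metric induced by
`dx² + dy² + κ ds²`. In the coordinates `(x, y, √|κ| s)` this is the round sphere of radius `1/√κ` in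
Euclidean space if `κ > 0` and one sheet of the two-sheeted hyperboloid in Minkowski space if
`κ < 0`. If `κ = 0` it is the graph of `(x² + y²)/2`, with the metric `dx² + dy²`, i.e. the
Euclidean plane. -/
def modelSurface (κ : ℝ) : EmbeddedRiemannian (Fin 3 → ℝ) where
  carrier := {q | q 0 ^ 2 + q 1 ^ 2 + κ * q 2 ^ 2 = 2 * q 2 ∧ 0 ≤ q 2}
  tangent q := {u | q 0 * u 0 + q 1 * u 1 + (κ * q 2 - 1) * u 2 = 0}
  metric _ u v := u 0 * v 0 + u 1 * v 1 + κ * (u 2 * v 2)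

/-- The vector space `ℝ³ × ℝ` in which all three-dimensional models live. -/
abbrev AmbientSpace : Type := (Fin 3 → ℝ) × ℝ

/-- The four coordinates of a vector of `ℝ³ × ℝ`. -/
def coords (u : AmbientSpace) : Fin 4 → ℝ := ![u.1 0, u.1 1, u.1 2, u.2]

/-- The determinant of four vectors of `ℝ³ × ℝ` in the standard coordinates. -/
def det4 (a b c d : AmbientSpace) : ℝ :=
  Matrix.det (Matrix.of ![coords a, coords b, coords c, coords d])

/-- An embedded oriented Riemannian three-manifold with a distinguished vector field `ξ`; the
orientation is recorded by the Riemannian volume form `vol`, so that the cross product is given by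
`⟨u × v, w⟩ = vol u v w`. -/
structure OrientedModel extends EmbeddedRiemannian AmbientSpace where
  ξ : AmbientSpace → AmbientSpace
  vol : AmbientSpace → AmbientSpace → AmbientSpace → AmbientSpace → ℝ

/-- The Riemannian product `𝕄²(κ) × ℝ`, with `ξ = ∂_z`. The vector
`n = (-κ x, -κ y, 1 - κ s)` is transverse to `𝕄²(κ)`, and `det(u, v, n)` is its area form. -/
def productSpace (κ : ℝ) : OrientedModel where
  carrier := {p | p.1 ∈ (modelSurface κ).carrier}
  tangent p := {u | u.1 ∈ (modelSurface κ).tangent p.1}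
  metric p u v := (modelSurface κ).metric p.1 u.1 v.1 + u.2 * v.2
  ξ _ := (0, 1)
  vol p u v w := det4 u v (![-κ * p.1 0, -κ * p.1 1, 1 - κ * p.1 2], 0) w

/-- The conformal factor `λ_κ = 1 / (1 + κ (x² + y²) / 4)`. -/
def cartanFactor (κ : ℝ) (p : AmbientSpace) : ℝ :=
  1 / (1 + κ / 4 * (p.1 0 ^ 2 + p.1 1 ^ 2))

/-- The connection form `dz + λ_κ τ (y dx - x dy)`. -/
def cartanForm (κ τ : ℝ) (p u : AmbientSpace) : ℝ :=
  u.2 + cartanFactor κ p * τ * (p.1 1 * u.1 0 - p.1 0 * u.1 1)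

/-- Cartan's model `{(x, y, z) | λ_κ(x, y) > 0}` with the metric
`λ_κ² (dx² + dy²) + (dz + λ_κ τ (y dx - x dy))²`, with `ξ = ∂_z` and the orientation of `ℝ³`; the
point `(x, y, z)` is written `((x, y, 0), z)`. -/
def cartanModel (κ τ : ℝ) : OrientedModel where
  carrier := {p | p.1 2 = 0 ∧ 0 < cartanFactor κ p}
  tangent _ := {u | u.1 2 = 0}
  metric p u v := cartanFactor κ p ^ 2 * (u.1 0 * v.1 0 + u.1 1 * v.1 1)
    + cartanForm κ τ p u * cartanForm κ τ p v
  ξ _ := (0, 1)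
  vol p u v w := cartanFactor κ p ^ 2 * det4 u v (![0, 0, 1], 0) w

/-- The Euclidean inner product of `ℝ⁴`. -/
def euclDot (u v : AmbientSpace) : ℝ :=
  u.1 0 * v.1 0 + u.1 1 * v.1 1 + u.1 2 * v.1 2 + u.2 * v.2

/-- The vector field `κ / (4 τ) (i z, i w)` of `ℂ² = ℝ⁴`. -/
def hopfField (κ τ : ℝ) (p : AmbientSpace) : AmbientSpace :=
  (κ / (4 * τ)) • ((![-p.1 1, p.1 0, -p.2], p.1 2) : AmbientSpace)

/-- The Berger sphere: the unit sphere of `ℂ²` with the metric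
`4/κ (⟨X, Y⟩ + 16 τ²/κ² (4 τ²/κ - 1) ⟨X, ξ⟩ ⟨Y, ξ⟩)`, where `ξ = κ/(4τ) (i z, i w)`. The point
`(z, w)` is written `((Re z, Im z, Re w), Im w)`. The orientation is the one
for which `∇_X ξ = τ X × ξ`. -/
def bergerSphere (κ τ : ℝ) : OrientedModel where
  carrier := {p | euclDot p p = 1}
  tangent p := {u | euclDot p u = 0}
  metric p u v := 4 / κ * (euclDot u v + 16 * τ ^ 2 / κ ^ 2 * (4 * τ ^ 2 / κ - 1) *
    (euclDot u (hopfField κ τ p) * euclDot v (hopfField κ τ p)))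
  ξ := hopfField κ τ
  vol p u v w := -(16 * τ / κ ^ 2) * det4 u v p w

/-- The simply connected homogeneous space `𝔼(κ, τ)`: the product `𝕄²(κ) × ℝ` if `τ = 0`, the Berger
sphere if `τ ≠ 0` and `κ > 0`, and Cartan's (in that case global) model if `τ ≠ 0` and `κ ≤ 0`. -/
def Ekt (κ τ : ℝ) : OrientedModel :=
  open Classical in
  if τ = 0 then productSpace κ else if 0 < κ then bergerSphere κ τ else cartanModel κ τ

section Immersions

variable {HS S : Type*} [TopologicalSpace HS] [TopologicalSpace S]
  (I : ModelWithCorners ℝ (EuclideanSpace ℝ (Fin 2)) HS) [ChartedSpace HS S]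

/-- The differential at `p` of a vector-valued map on the surface `S`. -/
def surfaceDiff (f : S → AmbientSpace) (p : S) : TangentSpace I p →ₗ[ℝ] AmbientSpace :=
  (mfderiv I 𝓘(ℝ, AmbientSpace) f p).toLinearMap

/-- A quadruplet `(A, T, J, ν)` of (fields of) operators `A` and `J`, a vector field `T` and a
function `ν` on the surface `S`. -/
structure SurfaceData where
  A : ∀ p : S, TangentSpace I p →ₗ[ℝ] TangentSpace I p
  T : ∀ p : S, TangentSpace I p
  J : ∀ p : S, TangentSpace I p →ₗ[ℝ] TangentSpace I p
  ν : S → ℝ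

variable {I}

/-- The transformation `(A, T, J, ν) ↦ (J ∘ A + H id, J T, J, ν)`. -/
def SurfaceData.conjugate (H : ℝ) (D : SurfaceData I (S := S)) : SurfaceData I (S := S) where
  A p := D.J p ∘ₗ D.A p + H • LinearMap.id
  T p := D.J p (D.T p)
  J := D.J
  ν := D.ν

variable [RiemannianBundle (fun p : S => TangentSpace I p)]

/-- `φ` is a smooth isometric immersion of the Riemannian surface `S` in `E`, `N` is a smooth unit
normal field along it, and `D = (A, T, J, ν)` is its fundamental data with respect to `N`. -/
structure HasFundamentalData (E : OrientedModel) (φ N : S → AmbientSpace)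
    (D : SurfaceData I (S := S)) : Prop where
  smooth : ContMDiff I 𝓘(ℝ, AmbientSpace) ∞ φ
  mem : ∀ p, φ p ∈ E.carrier
  isometric : ∀ (p : S) (u v : TangentSpace I p),
    E.metric (φ p) (surfaceDiff I φ p u) (surfaceDiff I φ p v) = ⟪u, v⟫_ℝ
  normal_smooth : ContMDiff I 𝓘(ℝ, AmbientSpace) ∞ N
  normal_mem : ∀ p, N p ∈ E.tangent (φ p)
  normal_unit : ∀ p, E.metric (φ p) (N p) (N p) = 1
  normal_orthogonal : ∀ (p : S) (u : TangentSpace I p),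
    E.metric (φ p) (N p) (surfaceDiff I φ p u) = 0
  /-- `A u = -∇_u N` -/
  shape : ∀ (p : S) (u v : TangentSpace I p),
    ⟪D.A p u, v⟫_ℝ =
      -E.covInner (φ p) (surfaceDiff I φ p u) (N p) (surfaceDiff I N p u) (surfaceDiff I φ p v)
  angle : ∀ p, D.ν p = E.metric (φ p) (E.ξ (φ p)) (N p)
  tangent_part : ∀ p, surfaceDiff I φ p (D.T p) = E.ξ (φ p) - D.ν p • N p
  /-- `dφ (J u) = N × dφ u` -/
  rotation : ∀ (p : S) (u : TangentSpace I p), ∀ w ∈ E.tangent (φ p),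
    E.metric (φ p) (surfaceDiff I φ p (D.J p u)) w = E.vol (φ p) (N p) (surfaceDiff I φ p u) w

/-- `φt : S → 𝔼(4H² + κ, H)` is an isometric minimal immersion with unit normal `Nt` and
fundamental data `D`, and `φ : S → 𝕄²(κ) × ℝ` is a conjugate isometric immersion, with unit normal
`N`: its fundamental data is `(J ∘ A + H id, J T, J, ν)`, where `D = (A, T, J, ν)`. In particular `φ`
has constant mean curvature `H`. -/
structure AreConjugate (κ H : ℝ) (φt Nt φ N : S → AmbientSpace) (D : SurfaceData I (S := S)) :
    Prop where
  source : HasFundamentalData (Ekt (4 * H ^ 2 + κ) H) φt Nt D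
  minimal : ∀ p, LinearMap.trace ℝ (TangentSpace I p) (D.A p) = 0
  target : HasFundamentalData (productSpace κ) φ N (D.conjugate H)

/-- `α : [0, ℓ] → S` is a smooth curve parametrised by arc length. -/
structure IsUnitSpeedCurve (I : ModelWithCorners ℝ (EuclideanSpace ℝ (Fin 2)) HS)
    [RiemannianBundle (fun p : S => TangentSpace I p)] (α : ℝ → S) (ℓ : ℝ) : Prop where
  smooth : ContMDiffOn 𝓘(ℝ, ℝ) I ∞ α (Icc 0 ℓ)
  speed : ∀ t ∈ Icc 0 ℓ,
    ‖(mfderivWithin 𝓘(ℝ, ℝ) I α (Icc 0 ℓ) t (1 : ℝ) : TangentSpace I (α t))‖ = 1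

end Immersions

/-- `γ : [0, ℓ] → E` is a segment of a horizontal geodesic: a geodesic orthogonal to `ξ`. -/
structure IsHorizontalGeodesic (E : OrientedModel) (γ : ℝ → AmbientSpace) (ℓ : ℝ) : Prop where
  geodesic : E.IsGeodesicOn γ (Icc 0 ℓ)
  horizontal : ∀ t ∈ Icc 0 ℓ, E.metric (γ t) (derivWithin γ (Icc 0 ℓ) t) (E.ξ (γ t)) = 0

/-- `(u, v, w)` is a positively oriented orthonormal basis of the tangent space of `E` at `p`. -/
structure IsPositiveFrame (E : OrientedModel) (p u v w : AmbientSpace) : Prop where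
  mem₁ : u ∈ E.tangent p
  mem₂ : v ∈ E.tangent p
  mem₃ : w ∈ E.tangent p
  unit₁ : E.metric p u u = 1
  unit₂ : E.metric p v v = 1
  unit₃ : E.metric p w w = 1
  orthogonal₁₂ : E.metric p u v = 0
  orthogonal₁₃ : E.metric p u w = 0
  orthogonal₂₃ : E.metric p v w = 0
  positive : 0 < E.vol p u v w

/-- `θ` is an angle of rotation along `γ` of the unit normal `N` (given as a field along `γ`):
a smooth function on `[0, ℓ]` with `N = cos θ X + sin θ ξ`, where `(γ', ξ, X)` is a positively
oriented orthonormal frame along `γ`. -/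
structure IsRotationAngle (E : OrientedModel) (γ N X : ℝ → AmbientSpace) (ℓ : ℝ) (θ : ℝ → ℝ) :
    Prop where
  smooth : ContDiffOn ℝ ∞ θ (Icc 0 ℓ)
  frame : ∀ t ∈ Icc 0 ℓ, IsPositiveFrame E (γ t) (derivWithin γ (Icc 0 ℓ) t) (E.ξ (γ t)) (X t)
  normal : ∀ t ∈ Icc 0 ℓ, N t = Real.cos (θ t) • X t + Real.sin (θ t) • E.ξ (γ t)

/-- `c : ℝ → 𝕄²(κ)` is a complete geodesic parametrised by arc length. -/
structure IsCompleteGeodesic (κ : ℝ) (c : ℝ → Fin 3 → ℝ) : Prop where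
  geodesic : (modelSurface κ).IsGeodesicOn c univ
  speed : ∀ s, (modelSurface κ).metric (c s) (deriv c s) (deriv c s) = 1

/-- The vertical plane of `𝕄²(κ) × ℝ` over the geodesic `c` of `𝕄²(κ)`, i.e. the preimage of (the
image of) `c` under the projection to `𝕄²(κ)`, with the induced metric. -/
def verticalPlane (κ : ℝ) (c : ℝ → Fin 3 → ℝ) : EmbeddedRiemannian AmbientSpace where
  carrier := {p | ∃ s, p.1 = c s}
  tangent p := {u | ∃ s a : ℝ, p.1 = c s ∧ u.1 = a • deriv c s}
  metric := (productSpace κ).metric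

/-- A surface with unit normal `N` at its point `p` meets the surface `P` of `E` orthogonally at
`p`: `N` is orthogonal to the normal direction of `P`. -/
def MeetsOrthogonallyAt (E : OrientedModel) (P : EmbeddedRiemannian AmbientSpace)
    (p N : AmbientSpace) : Prop :=
  p ∈ P.carrier ∧ ∀ n ∈ E.tangent p, (∀ w ∈ P.tangent p, E.metric p n w = 0) → E.metric p N n = 0

end

/-!
Let `e = α'`, let `μ = ⟨T̃, J e⟩`, and let `k = ⟨A e, e⟩` for the shape operator `A = J Ã + H` of
`φ`.

Since `φt ∘ α` is a geodesic, its normal and its conormal acceleration both vanish. The first says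
`⟨Ã e, e⟩ = 0`, hence `⟨A e, J e⟩ = 0`. The second is intrinsic: it only depends on the induced
metric, through its Christoffel symbols (`accelInner_eq_of_eventuallyEq_comp`,
`accelInner_comp_curve_eq`), and so passes to `φ ∘ α`. Since `φt ∘ α` is horizontal, `T̃ = μ J e`,
hence `J T̃ = -μ e` and `∂_z = -μ γ' + ν N` along `γ = φ ∘ α`. These are the properties recorded in
`IsAdaptedCurve`. The last one gives `z' = -μ` and `z'² + ν² = 1`, from which (a) follows.

Consequently the conormal `N × γ'` is horizontal and parallel along `γ`. As `𝕄²(κ)` is a quadric of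
`ℝ³` and the conormal is orthogonal to `γ'`, being parallel means being a constant vector `(a, 0)`
of `ℝ³ × ℝ` (`conormal_eq_initial`). So the projection `β` of `γ` stays in the section of the
quadric by a plane through its centre (a vertical plane if `κ = 0`), which is a geodesic with normal
`a`; explicitly, `β` and the unit vector `b = ν β' - z' N.1` satisfy `β' = ν b` and `b' = ν n(β)`,
the Frenet equations of that geodesic up to the factor `ν` (`exists_geodesicWithNormal`). The vertical
plane over it is cut out by an affine equation with linear part `⟨a, ·⟩`, so it is totally geodesic,
and `N` is orthogonal to `(a, 0)`.

For (b), `ξ = μ η + ν Ñ` and `γ̃' × ξ = μ Ñ - ν η` with `η = dφt (J e)`. Hence the angles of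
rotation are exactly the smooth functions `θ` with `cos θ = μ = -z'` and `sin θ = ν`. On the other
hand, taking the vertical components of `γ''` and `N'` gives `μ' = -ν k` and `ν' = μ k`, so that
`θ' = k`, which is the curvature `⟨γ'', N⟩` of `γ`.
-/

/-! ### The quadric model of the surface of constant curvature -/

/-- The bilinear form `dx² + dy² + κ ds²` of `ℝ³`, which induces the metric of `𝕄²(κ)`. -/
def modelForm (κ : ℝ) (u v : Fin 3 → ℝ) : ℝ := u 0 * v 0 + u 1 * v 1 + κ * (u 2 * v 2)

/-- The linear form whose kernel is the tangent plane of `𝕄²(κ)` at `q`; it is half the differential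
of the equation of the quadric. -/
def conormalForm (κ : ℝ) (q u : Fin 3 → ℝ) : ℝ := q 0 * u 0 + q 1 * u 1 + (κ * q 2 - 1) * u 2

/-- The transverse field of `𝕄²(κ)`, orthogonal to the tangent planes for `modelForm κ`. -/
def modelNormal (κ : ℝ) (q : Fin 3 → ℝ) : Fin 3 → ℝ := ![-κ * q 0, -κ * q 1, 1 - κ * q 2]

/-- The determinant `det (u, v, n)` with the transverse field `n`: on tangent vectors, the area form
of `𝕄²(κ)`. -/
def areaForm (κ : ℝ) (q u v : Fin 3 → ℝ) : ℝ :=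
  -κ * q 0 * (u 1 * v 2 - u 2 * v 1) - κ * q 1 * (u 2 * v 0 - u 0 * v 2)
    + (1 - κ * q 2) * (u 0 * v 1 - u 1 * v 0)

/-- The rotation by a right angle in the tangent plane of `𝕄²(κ)` at `q`. -/
def modelRotation (κ : ℝ) (q a : Fin 3 → ℝ) : Fin 3 → ℝ :=
  ![-κ * q 1 * a 2 - (1 - κ * q 2) * a 1, (1 - κ * q 2) * a 0 + κ * q 0 * a 2,
    q 1 * a 0 - q 0 * a 1]

theorem mem_tangent_modelSurface {κ : ℝ} {q u : Fin 3 → ℝ} :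
    u ∈ (modelSurface κ).tangent q ↔ conormalForm κ q u = 0 := Iff.rfl

theorem metric_modelSurface {κ : ℝ} (q u v : Fin 3 → ℝ) :
    (modelSurface κ).metric q u v = modelForm κ u v := rfl

theorem modelNormal_zero (κ : ℝ) (q : Fin 3 → ℝ) : modelNormal κ q 0 = -κ * q 0 := rfl

theorem modelNormal_one (κ : ℝ) (q : Fin 3 → ℝ) : modelNormal κ q 1 = -κ * q 1 := rfl

theorem modelNormal_two (κ : ℝ) (q : Fin 3 → ℝ) : modelNormal κ q 2 = 1 - κ * q 2 := rfl

section ModelAlgebra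

variable {κ : ℝ} {q a b u v w : Fin 3 → ℝ} {r : ℝ}

theorem modelForm_comm : modelForm κ u v = modelForm κ v u := by simp only [modelForm]; ring

theorem modelForm_add_left : modelForm κ (u + v) w = modelForm κ u w + modelForm κ v w := by
  simp only [modelForm, Pi.add_apply]; ring

theorem modelForm_sub_left : modelForm κ (u - v) w = modelForm κ u w - modelForm κ v w := by
  simp only [modelForm, Pi.sub_apply]; ring

theorem modelForm_smul_left : modelForm κ (r • u) w = r * modelForm κ u w := by
  simp only [modelForm, Pi.smul_apply, smul_eq_mul]; ring

theorem modelForm_add_right : modelForm κ w (u + v) = modelForm κ w u + modelForm κ w v := by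
  simp only [modelForm, Pi.add_apply]; ring

theorem modelForm_sub_right : modelForm κ w (u - v) = modelForm κ w u - modelForm κ w v := by
  simp only [modelForm, Pi.sub_apply]; ring

theorem modelForm_smul_right : modelForm κ w (r • u) = r * modelForm κ w u := by
  simp only [modelForm, Pi.smul_apply, smul_eq_mul]; ring

theorem conormalForm_add : conormalForm κ q (u + v) = conormalForm κ q u + conormalForm κ q v := by
  simp only [conormalForm, Pi.add_apply]; ring

theorem conormalForm_sub : conormalForm κ q (u - v) = conormalForm κ q u - conormalForm κ q v := by
  simp only [conormalForm, Pi.sub_apply]; ring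

theorem conormalForm_smul : conormalForm κ q (r • u) = r * conormalForm κ q u := by
  simp only [conormalForm, Pi.smul_apply, smul_eq_mul]; ring

/-- The tangent plane of the quadric varies with the point through `modelForm` only. -/
theorem conormalForm_add_point :
    conormalForm κ (q + v) u = conormalForm κ q u + modelForm κ v u := by
  simp only [conormalForm, modelForm, Pi.add_apply]; ring

theorem modelForm_modelNormal : modelForm κ (modelNormal κ q) u = -κ * conormalForm κ q u := by
  simp [modelForm, modelNormal, conormalForm]; ring

theorem conormalForm_modelNormal (hq : q ∈ (modelSurface κ).carrier) :
    conormalForm κ q (modelNormal κ q) = -1 := by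
  have h := hq.1
  simp [modelNormal, conormalForm]
  linear_combination -κ * h

theorem modelForm_modelNormal_self (hq : q ∈ (modelSurface κ).carrier) :
    modelForm κ (modelNormal κ q) (modelNormal κ q) = κ := by
  rw [modelForm_modelNormal, conormalForm_modelNormal hq]; ring

theorem modelForm_modelRotation : modelForm κ (modelRotation κ q a) u = areaForm κ q a u := by
  simp [modelForm, modelRotation, areaForm]; ring

theorem conormalForm_modelRotation : conormalForm κ q (modelRotation κ q a) = 0 := by
  simp [conormalForm, modelRotation]; ring

theorem modelForm_modelRotation_modelRotation (hq : q ∈ (modelSurface κ).carrier)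
    (hu : conormalForm κ q u = 0) :
    modelForm κ (modelRotation κ q u) (modelRotation κ q v) = modelForm κ u v := by
  have h := hq.1
  simp only [conormalForm] at hu
  simp [modelForm, modelRotation]
  linear_combination (u 0 * v 0 + u 1 * v 1 + κ * (u 2 * v 2)) * κ * h
    - κ * (q 0 * v 0 + q 1 * v 1 + (κ * q 2 - 1) * v 2) * hu

/-- On tangent vectors the square of the area form is the Gram determinant. -/
theorem areaForm_sq (hq : q ∈ (modelSurface κ).carrier) (hu : conormalForm κ q u = 0)
    (hv : conormalForm κ q v = 0) :
    areaForm κ q u v ^ 2 = modelForm κ u u * modelForm κ v v - modelForm κ u v ^ 2 := by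
  have h := hq.1
  simp only [conormalForm] at hu hv
  -- `u × v` is parallel to the coefficient vector of the form that annihilates `u` and `v`
  have h0 : (u 2 * v 0 - u 0 * v 2) * (κ * q 2 - 1) - (u 0 * v 1 - u 1 * v 0) * q 1 = 0 := by
    linear_combination v 0 * hu - u 0 * hv
  have h1 : (u 0 * v 1 - u 1 * v 0) * q 0 - (u 1 * v 2 - u 2 * v 1) * (κ * q 2 - 1) = 0 := by
    linear_combination v 1 * hu - u 1 * hv
  have h2 : (u 1 * v 2 - u 2 * v 1) * q 1 - (u 2 * v 0 - u 0 * v 2) * q 0 = 0 := by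
    linear_combination v 2 * hu - u 2 * hv
  simp only [areaForm, modelForm]
  linear_combination
    (κ * (u 1 * v 2 - u 2 * v 1) ^ 2 + κ * (u 2 * v 0 - u 0 * v 2) ^ 2
      + (u 0 * v 1 - u 1 * v 0) ^ 2) * κ * h
    - κ * ((u 2 * v 0 - u 0 * v 2) * (κ * q 2 - 1) - (u 0 * v 1 - u 1 * v 0) * q 1) * h0
    - κ * ((u 0 * v 1 - u 1 * v 0) * q 0 - (u 1 * v 2 - u 2 * v 1) * (κ * q 2 - 1)) * h1
    - κ ^ 2 * ((u 1 * v 2 - u 2 * v 1) * q 1 - (u 2 * v 0 - u 0 * v 2) * q 0) * h2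

/-- The expansion of a tangent vector in an orthonormal frame. -/
theorem eq_frame_expansion (hq : q ∈ (modelSurface κ).carrier)
    (ha : conormalForm κ q a = 0) (hb : conormalForm κ q b = 0) (hu : conormalForm κ q u = 0)
    (haa : modelForm κ a a = 1) (hbb : modelForm κ b b = 1) (hab : modelForm κ a b = 0) :
    u = modelForm κ u a • a + modelForm κ u b • b := by
  have hne : areaForm κ q a b ≠ 0 := by
    intro h0
    have := areaForm_sq hq ha hb
    rw [h0, haa, hbb, hab] at this
    norm_num at this
  set d : ℝ := u 0 * (a 1 * b 2 - a 2 * b 1) + u 1 * (a 2 * b 0 - a 0 * b 2)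
    + u 2 * (a 0 * b 1 - a 1 * b 0)
  have cramer : areaForm κ q a b • u
      = areaForm κ q u b • a + areaForm κ q a u • b + d • modelNormal κ q := by
    ext i
    fin_cases i <;> simp [areaForm, modelNormal, d] <;> ring
  have hd : d = 0 := by
    have := congrArg (conormalForm κ q) cramer
    simp only [conormalForm_add, conormalForm_smul, ha, hb, hu, conormalForm_modelNormal hq] at this
    linarith
  rw [hd, zero_smul, add_zero] at cramer
  have h1 : areaForm κ q a b * modelForm κ u a = areaForm κ q u b := by
    have := congrArg (fun x => modelForm κ x a) cramer
    simpa [modelForm_add_left, modelForm_smul_left, haa, modelForm_comm (u := b) (v := a), hab]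
      using this
  have h2 : areaForm κ q a b * modelForm κ u b = areaForm κ q a u := by
    have := congrArg (fun x => modelForm κ x b) cramer
    simpa [modelForm_add_left, modelForm_smul_left, hbb, hab] using this
  apply smul_right_injective _ hne
  simp only [smul_add, smul_smul]
  rw [h1, h2, cramer]

theorem eq_zero_of_orthogonal_frame (hq : q ∈ (modelSurface κ).carrier)
    (ha : conormalForm κ q a = 0) (hb : conormalForm κ q b = 0) (hu : conormalForm κ q u = 0)
    (haa : modelForm κ a a = 1) (hbb : modelForm κ b b = 1) (hab : modelForm κ a b = 0)
    (hua : modelForm κ u a = 0) (hub : modelForm κ u b = 0) : u = 0 := by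
  rw [eq_frame_expansion hq ha hb hu haa hbb hab, hua, hub]; simp

/-- The metric is nondegenerate on the tangent planes. -/
theorem eq_zero_of_orthogonal_tangent (hq : q ∈ (modelSurface κ).carrier)
    (hu : conormalForm κ q u = 0)
    (h : ∀ w, conormalForm κ q w = 0 → modelForm κ u w = 0) : u = 0 := by
  -- test against the tangential projections of the vectors of the standard basis
  have key : ∀ w, modelForm κ u w = 0 := by
    intro w
    have := h (w + conormalForm κ q w • modelNormal κ q) (by
      rw [conormalForm_add, conormalForm_smul, conormalForm_modelNormal hq]; ring)
    rwa [modelForm_add_right, modelForm_smul_right, modelForm_comm (v := modelNormal κ q),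
      modelForm_modelNormal, hu, mul_zero, mul_zero, add_zero] at this
  have h0 := key ![1, 0, 0]
  have h1 := key ![0, 1, 0]
  have h2 := key ![0, 0, 1]
  simp [modelForm] at h0 h1
  have h2' : κ * u 2 = 0 := by simpa only [modelForm, Matrix.cons_val, mul_zero, mul_one, zero_add]
    using h2
  simp only [conormalForm, h0, h1] at hu
  have h3 : u 2 = 0 := by linear_combination q 2 * h2' - hu
  ext i
  fin_cases i
  exacts [h0, h1, h3]

end ModelAlgebra

/-! ### Geodesics of the model surface and the vertical planes over them -/

/-- The generalised sine `S` of curvature `κ` together with its primitive `C`, for which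
`S' = 1 - κ C` is the generalised cosine. -/
theorem exists_generalized_sine (κ : ℝ) : ∃ S C : ℝ → ℝ, ContDiff ℝ ∞ S ∧ ContDiff ℝ ∞ C ∧
    (∀ s, HasDerivAt S (1 - κ * C s) s) ∧ (∀ s, HasDerivAt C (S s) s) ∧ S 0 = 0 ∧ C 0 = 0 ∧
    ∀ s, S s ^ 2 + κ * C s ^ 2 = 2 * C s := by
  rcases lt_trichotomy κ 0 with hκ | rfl | hκ
  · obtain ⟨k, hk, rfl⟩ : ∃ k : ℝ, 0 < k ∧ κ = -k ^ 2 :=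
      ⟨√(-κ), Real.sqrt_pos.2 (by linarith), by rw [Real.sq_sqrt (by linarith)]; ring⟩
    refine ⟨fun s => Real.sinh (k * s) / k, fun s => (Real.cosh (k * s) - 1) / k ^ 2,
      by fun_prop, by fun_prop, fun s => ?_, fun s => ?_, by simp, by simp, fun s => ?_⟩
    · have h := (((hasDerivAt_id s).const_mul k).sinh).div_const k
      refine h.congr_deriv ?_
      simp only [id]; field_simp; ring
    · have h := ((((hasDerivAt_id s).const_mul k).cosh).sub_const 1).div_const (k ^ 2)
      refine h.congr_deriv ?_
      simp only [id]; field_simp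
    · have := Real.cosh_sq (k * s)
      field_simp
      linear_combination -this
  · exact ⟨fun s => s, fun s => s ^ 2 / 2, by fun_prop, by fun_prop,
      fun s => by simpa using hasDerivAt_id' s, fun s => by
        simpa using ((hasDerivAt_id s).pow 2).div_const 2, rfl, by simp, fun s => by ring⟩
  · obtain ⟨k, hk, rfl⟩ : ∃ k : ℝ, 0 < k ∧ κ = k ^ 2 :=
      ⟨√κ, Real.sqrt_pos.2 hκ, by rw [Real.sq_sqrt hκ.le]⟩
    refine ⟨fun s => Real.sin (k * s) / k, fun s => (1 - Real.cos (k * s)) / k ^ 2,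
      by fun_prop, by fun_prop, fun s => ?_, fun s => ?_, by simp, by simp, fun s => ?_⟩
    · have h := (((hasDerivAt_id s).const_mul k).sin).div_const k
      refine h.congr_deriv ?_
      simp only [id]; field_simp; ring
    · have h := ((((hasDerivAt_id s).const_mul k).cos).const_sub 1).div_const (k ^ 2)
      refine h.congr_deriv ?_
      simp only [id]; field_simp
    · have := Real.sin_sq_add_cos_sq (k * s)
      field_simp
      linear_combination this

theorem modelSurface_christoffel (κ : ℝ) (p u v w : Fin 3 → ℝ) :
    (modelSurface κ).christoffel p u v w = 0 := by
  simp [EmbeddedRiemannian.christoffel, modelSurface]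

theorem productSpace_christoffel (κ : ℝ) (p u v w : AmbientSpace) :
    (productSpace κ).christoffel p u v w = 0 := by
  simp [EmbeddedRiemannian.christoffel, productSpace, modelSurface]

/-- A curve of the quadric that starts on the sheet `0 ≤ s` stays on it. -/
theorem nonneg_of_mem_quadric {κ : ℝ} {c : ℝ → Fin 3 → ℝ} (hc : Continuous c)
    (hq : ∀ s, c s 0 ^ 2 + c s 1 ^ 2 + κ * c s 2 ^ 2 = 2 * c s 2) (h0 : 0 ≤ c 0 2) (s : ℝ) :
    0 ≤ c s 2 := by
  rcases le_or_gt 0 κ with hκ | hκ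
  · nlinarith [hq s, sq_nonneg (c s 0), sq_nonneg (c s 1), mul_nonneg hκ (sq_nonneg (c s 2))]
  · -- `1 - κ s` vanishes nowhere on the quadric
    by_contra hneg
    push Not at hneg
    have hcont : Continuous fun r => 1 - κ * c r 2 := by fun_prop
    have hne : ∀ r, 1 - κ * c r 2 ≠ 0 := by
      intro r hr
      nlinarith [hq r, sq_nonneg (c r 0), sq_nonneg (c r 1)]
    have h1 : 0 ≤ 1 - κ * c 0 2 := by nlinarith
    have h2 : 1 - κ * c s 2 ≤ 0 := by
      have : c s 2 * (2 - κ * c s 2) ≥ 0 := by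
        nlinarith [hq s, sq_nonneg (c s 0), sq_nonneg (c s 1)]
      have : 2 - κ * c s 2 ≤ 0 := by
        by_contra h
        push Not at h
        nlinarith
      linarith
    obtain ⟨r, hr⟩ := mem_range_of_exists_le_of_exists_ge hcont ⟨s, h2⟩ ⟨0, h1⟩
    exact hne r hr

/-- A complete geodesic `c` of `𝕄²(κ)` together with a constant vector `a` of `ℝ³` which is the unit
normal of `c` in `𝕄²(κ)`: the geodesics of the quadric are its sections by the planes through the
centre, or by the vertical planes if `κ = 0`. -/
structure GeodesicWithNormal (κ : ℝ) (c : ℝ → Fin 3 → ℝ) (a : Fin 3 → ℝ) : Prop where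
  geodesic : IsCompleteGeodesic κ c
  tangent : ∀ s, conormalForm κ (c s) (deriv c s) = 0
  normal_tangent : ∀ s, conormalForm κ (c s) a = 0
  normal_unit : modelForm κ a a = 1
  normal_orthogonal : ∀ s, modelForm κ a (deriv c s) = 0

section Geodesic

variable {κ : ℝ} {q a b : Fin 3 → ℝ} {S C : ℝ → ℝ}

theorem hasDerivAt_geodesic (hS : ∀ s, HasDerivAt S (1 - κ * C s) s)
    (hC : ∀ s, HasDerivAt C (S s) s) (s : ℝ) :
    HasDerivAt (fun s => q + S s • b + C s • modelNormal κ q)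
      ((1 - κ * C s) • b + S s • modelNormal κ q) s :=
  (((hS s).smul_const b).const_add q).add ((hC s).smul_const _)

theorem geodesicWithNormal (hq : q ∈ (modelSurface κ).carrier)
    (ha : conormalForm κ q a = 0) (hb : conormalForm κ q b = 0)
    (haa : modelForm κ a a = 1) (hbb : modelForm κ b b = 1) (hab : modelForm κ a b = 0)
    (hSc : ContDiff ℝ ∞ S) (hCc : ContDiff ℝ ∞ C)
    (hS : ∀ s, HasDerivAt S (1 - κ * C s) s) (hC : ∀ s, HasDerivAt C (S s) s)
    (hS0 : S 0 = 0) (hC0 : C 0 = 0) (hSC : ∀ s, S s ^ 2 + κ * C s ^ 2 = 2 * C s) :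
    GeodesicWithNormal κ (fun s => q + S s • b + C s • modelNormal κ q) a := by
  set c : ℝ → Fin 3 → ℝ := fun s => q + S s • b + C s • modelNormal κ q with hcdef
  have hd : deriv c = fun s => (1 - κ * C s) • b + S s • modelNormal κ q :=
    funext fun s => (hasDerivAt_geodesic hS hC s).deriv
  have hd2 : ∀ s, deriv (deriv c) s = modelNormal κ (c s) := by
    intro s
    rw [hd]
    have h : HasDerivAt (fun s => (1 - κ * C s) • b + S s • modelNormal κ q)
        ((-(κ * S s)) • b + (1 - κ * C s) • modelNormal κ q) s :=
      ((((hC s).const_mul κ).const_sub 1).smul_const b).add ((hS s).smul_const _)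
    rw [h.deriv, hcdef]
    ext i
    fin_cases i
    all_goals
      simp only [Fin.zero_eta, Fin.mk_one, Fin.reduceFinMk, Pi.add_apply, Pi.smul_apply,
        smul_eq_mul, modelNormal_zero, modelNormal_one, modelNormal_two]
      ring
  have hsm : ContDiff ℝ ∞ c := by fun_prop
  have hnn := modelForm_modelNormal_self hq
  have hnb : modelForm κ (modelNormal κ q) b = 0 := by rw [modelForm_modelNormal, hb, mul_zero]
  have hbn : modelForm κ b (modelNormal κ q) = 0 := by rw [modelForm_comm, hnb]
  have hna : modelForm κ (modelNormal κ q) a = 0 := by rw [modelForm_modelNormal, ha, mul_zero]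
  have hquad : ∀ s, c s 0 ^ 2 + c s 1 ^ 2 + κ * c s 2 ^ 2 = 2 * c s 2 := by
    intro s
    have e : ∀ v : Fin 3 → ℝ, (q + v) 0 ^ 2 + (q + v) 1 ^ 2 + κ * (q + v) 2 ^ 2 - 2 * (q + v) 2
        = 2 * conormalForm κ q v + modelForm κ v v := by
      intro v
      have := hq.1
      simp only [conormalForm, modelForm, Pi.add_apply]
      linear_combination this
    have := e (S s • b + C s • modelNormal κ q)
    simp only [conormalForm_add, conormalForm_smul, hb, conormalForm_modelNormal hq,
      modelForm_add_left, modelForm_add_right, modelForm_smul_left, modelForm_smul_right, hbb,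
      hnn, hnb, hbn, ← add_assoc] at this
    linear_combination this + hSC s
  have hmem : ∀ s, c s ∈ (modelSurface κ).carrier := fun s =>
    ⟨hquad s, nonneg_of_mem_quadric hsm.continuous hquad (by simpa [c, hS0, hC0] using hq.2) s⟩
  refine ⟨⟨⟨hsm.contDiffOn, fun t _ => hmem t, ?_⟩, ?_⟩, ?_, ?_, haa, ?_⟩
  · intro t _ w hw
    rw [mem_tangent_modelSurface] at hw
    simp only [EmbeddedRiemannian.accelInner, EmbeddedRiemannian.covInner,
      modelSurface_christoffel, derivWithin_univ, metric_modelSurface, add_zero]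
    change modelForm κ (deriv (deriv c) t) w = 0
    rw [hd2, modelForm_modelNormal, hw, mul_zero]
  · intro s
    rw [metric_modelSurface, hd]
    simp only [modelForm_add_left, modelForm_add_right, modelForm_smul_left, modelForm_smul_right,
      hbb, hnn, hnb, hbn]
    linear_combination κ * hSC s
  · intro s
    rw [hd, show c s = q + (S s • b + C s • modelNormal κ q) from add_assoc _ _ _,
      conormalForm_add_point]
    simp only [conormalForm_add, conormalForm_smul, hb, conormalForm_modelNormal hq,
      modelForm_add_left, modelForm_add_right, modelForm_smul_left, modelForm_smul_right,
      hbb, hnn, hnb, hbn]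
    ring
  · intro s
    rw [show c s = q + (S s • b + C s • modelNormal κ q) from add_assoc _ _ _,
      conormalForm_add_point, modelForm_add_left, modelForm_smul_left,
      modelForm_smul_left, hna, modelForm_comm (u := b), hab, ha]
    ring
  · intro s
    rw [hd, modelForm_comm, modelForm_add_left, modelForm_smul_left, modelForm_smul_left, hna,
      modelForm_comm (u := b), hab]
    ring

end Geodesic

theorem metric_productSpace {κ : ℝ} (p u v : AmbientSpace) :
    (productSpace κ).metric p u v = modelForm κ u.1 v.1 + u.2 * v.2 := rfl

theorem mem_tangent_productSpace {κ : ℝ} {p u : AmbientSpace} :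
    u ∈ (productSpace κ).tangent p ↔ conormalForm κ p.1 u.1 = 0 := Iff.rfl

theorem accelInner_productSpace (κ : ℝ) (γ : ℝ → AmbientSpace) (s : Set ℝ) (t : ℝ)
    (w : AmbientSpace) : (productSpace κ).accelInner γ s t w =
      (productSpace κ).metric (γ t) (derivWithin (fun r => derivWithin γ s r) s t) w := by
  simp only [EmbeddedRiemannian.accelInner, EmbeddedRiemannian.covInner,
    productSpace_christoffel, add_zero]

section VerticalPlane

variable {κ : ℝ} {c : ℝ → Fin 3 → ℝ} {a : Fin 3 → ℝ}

namespace GeodesicWithNormal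

theorem mem (hc : GeodesicWithNormal κ c a) (s : ℝ) : c s ∈ (modelSurface κ).carrier :=
  hc.geodesic.geodesic.mem s (mem_univ s)

/-- Tangent vectors of `𝕄²(κ) × ℝ` orthogonal to `(a, 0)` are tangent to the vertical plane. -/
theorem mem_tangent (hc : GeodesicWithNormal κ c a) {s : ℝ} {p u : AmbientSpace} (hp : p.1 = c s)
    (hu : conormalForm κ p.1 u.1 = 0) (hua : modelForm κ u.1 a = 0) :
    u ∈ (verticalPlane κ c).tangent p := by
  refine ⟨s, modelForm κ u.1 (deriv c s), hp, ?_⟩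
  have h := eq_frame_expansion (hc.mem s) (hc.normal_tangent s) (hc.tangent s) (hp ▸ hu)
    hc.normal_unit (hc.geodesic.speed s) (hc.normal_orthogonal s)
  rwa [hua, zero_smul, zero_add] at h

/-- The normals of the vertical plane are the multiples of `(a, 0)`. -/
theorem normal_eq (hc : GeodesicWithNormal κ c a) {p n : AmbientSpace}
    (hp : p ∈ (verticalPlane κ c).carrier) (hn : n ∈ (productSpace κ).tangent p)
    (h : ∀ w ∈ (verticalPlane κ c).tangent p, (productSpace κ).metric p n w = 0) :
    n = (modelForm κ n.1 a • a, 0) := by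
  obtain ⟨s, hs⟩ := hp
  have h1 := h (0, 1) ⟨s, 0, hs, by simp⟩
  have h2 := h (deriv c s, 0) ⟨s, 1, hs, by simp⟩
  rw [metric_productSpace] at h1 h2
  have h3 : n.2 = 0 := by simpa [modelForm] using h1
  have h4 : modelForm κ n.1 (deriv c s) = 0 := by simpa using h2
  rw [mem_tangent_productSpace, hs] at hn
  have h5 := eq_frame_expansion (hc.mem s) (hc.normal_tangent s) (hc.tangent s) hn
    hc.normal_unit (hc.geodesic.speed s) (hc.normal_orthogonal s)
  rw [h4, zero_smul, add_zero] at h5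
  exact Prod.ext h5 h3

/-- A vertical plane is totally geodesic, being cut out by an affine equation whose linear part is
`modelForm κ · a`. -/
theorem isTotallyGeodesicIn (hc : GeodesicWithNormal κ c a) :
    (verticalPlane κ c).IsTotallyGeodesicIn (productSpace κ).toEmbeddedRiemannian where
  subset := by
    rintro p ⟨s, hs⟩
    change p.1 ∈ (modelSurface κ).carrier
    rw [hs]
    exact hc.mem s
  tangent_subset := by
    rintro p - u ⟨s, r, hs, hu⟩
    rw [mem_tangent_productSpace, hs, hu, conormalForm_smul, hc.tangent, mul_zero]
  metric_eq _ _ _ _ _ _ := rfl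
  accel := by
    intro σ hσ hmem t n hn hnP
    rw [hc.normal_eq (hmem t) hn hnP, accelInner_productSpace, metric_productSpace]
    simp only [derivWithin_univ, mul_zero, add_zero, modelForm_smul_right]
    have hconst : (fun r => modelForm κ (σ r).1 a) = fun _ => a 2 := by
      funext r
      obtain ⟨s, hs⟩ := hmem r
      have := hc.normal_tangent s
      rw [← hs] at this
      simp only [conormalForm] at this
      simp only [modelForm]
      linear_combination this
    have hder : ∀ f : ℝ → AmbientSpace, Differentiable ℝ f →
        deriv (fun r => modelForm κ (f r).1 a) = fun r => modelForm κ (deriv f r).1 a := by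
      intro f hf
      funext r
      have h1 : HasDerivAt (fun r => (f r).1) (deriv f r).1 r := (hf r).hasDerivAt.fst
      have h2 := hasDerivAt_pi.1 h1
      exact ((((h2 0).mul_const (a 0)).add ((h2 1).mul_const (a 1))).add
        (((h2 2).mul_const (a 2)).const_mul κ)).deriv
    have hσ' : ContDiff ℝ ∞ (deriv σ) := by
      have : ContDiff ℝ (∞ + 1) σ := by simpa using hσ
      exact (contDiff_succ_iff_deriv.1 this).2.2
    have e1 := hder σ (hσ.differentiable (by simp))
    have e2 := hder (deriv σ) (hσ'.differentiable (by simp))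
    have : modelForm κ (deriv (deriv σ) t).1 a = 0 := by
      rw [← congrFun e2 t, ← e1, hconst]
      simp
    rw [this, mul_zero]

theorem meetsOrthogonallyAt (hc : GeodesicWithNormal κ c a) {p N : AmbientSpace}
    (hp : p ∈ (verticalPlane κ c).carrier) (hN : modelForm κ N.1 a = 0) :
    MeetsOrthogonallyAt (productSpace κ) (verticalPlane κ c) p N := by
  refine ⟨hp, fun n hn hnP => ?_⟩
  rw [hc.normal_eq hp hn hnP, metric_productSpace, modelForm_smul_right, hN]
  simp

end GeodesicWithNormal

end VerticalPlane

/-! ### Differential calculus of fields of bilinear forms -/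

namespace EmbeddedRiemannian

variable {V : Type*} [NormedAddCommGroup V] [NormedSpace ℝ V]

/-- The field of forms of `M` is symmetric, bilinear, and differentiable at the points of `M`. -/
structure IsDifferentiableMetric (M : EmbeddedRiemannian V) : Prop where
  add_left : ∀ p u u' v, M.metric p (u + u') v = M.metric p u v + M.metric p u' v
  smul_left : ∀ p (r : ℝ) u v, M.metric p (r • u) v = r * M.metric p u v
  symm : ∀ p u v, M.metric p u v = M.metric p v u
  differentiable : ∀ p ∈ M.carrier, ∀ u v,
    DifferentiableAt ℝ (fun x : V × V × V => M.metric x.1 x.2.1 x.2.2) (p, u, v)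

namespace IsDifferentiableMetric

variable {M : EmbeddedRiemannian V}

theorem add_right (h : M.IsDifferentiableMetric) (p u v v' : V) :
    M.metric p u (v + v') = M.metric p u v + M.metric p u v' := by
  rw [h.symm, h.add_left, h.symm p v, h.symm p v']

theorem smul_right (h : M.IsDifferentiableMetric) (p : V) (r : ℝ) (u v : V) :
    M.metric p u (r • v) = r * M.metric p u v := by
  rw [h.symm, h.smul_left, h.symm p v]

theorem sub_right (h : M.IsDifferentiableMetric) (p u v v' : V) :
    M.metric p u (v - v') = M.metric p u v - M.metric p u v' := by
  rw [sub_eq_add_neg, h.add_right, ← neg_one_smul ℝ v', h.smul_right]; ring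

theorem sub_left (h : M.IsDifferentiableMetric) (p u u' v : V) :
    M.metric p (u - u') v = M.metric p u v - M.metric p u' v := by
  rw [h.symm, h.sub_right, h.symm p v, h.symm p v]

/-- The product rule for `⟨Y, Z⟩` along a map `P` into `M`. -/
theorem hasFDerivWithinAt {F : Type*} [NormedAddCommGroup F] [NormedSpace ℝ F]
    (h : M.IsDifferentiableMetric) {P Y Z : F → V} {P' Y' Z' : F →L[ℝ] V} {s : Set F} {y : F}
    (hy : P y ∈ M.carrier) (hP : HasFDerivWithinAt P P' s y) (hY : HasFDerivWithinAt Y Y' s y)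
    (hZ : HasFDerivWithinAt Z Z' s y) :
    ∃ L : F →L[ℝ] ℝ, HasFDerivWithinAt (fun y => M.metric (P y) (Y y) (Z y)) L s y ∧
      ∀ d, L d = fderiv ℝ (fun x => M.metric x (Y y) (Z y)) (P y) (P' d)
        + M.metric (P y) (Y' d) (Z y) + M.metric (P y) (Y y) (Z' d) := by
  have hm := (h.differentiable _ hy (Y y) (Z y)).hasFDerivAt
  set D := fderiv ℝ (fun x : V × V × V => M.metric x.1 x.2.1 x.2.2) (P y, Y y, Z y)
  refine ⟨_, hm.comp_hasFDerivWithinAt (f := fun y => (P y, Y y, Z y)) y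
    (hP.prodMk (hY.prodMk hZ)), fun d => ?_⟩
  have h1 : fderiv ℝ (fun x => M.metric x (Y y) (Z y)) (P y) (P' d) = D (P' d, 0, 0) := by
    have : HasFDerivAt (fun x => M.metric x (Y y) (Z y))
        (D.comp (ContinuousLinearMap.inl ℝ V (V × V))) (P y) :=
      HasFDerivAt.comp (f := fun x => (x, Y y, Z y)) (P y) hm
        (hasFDerivAt_prodMk_left (P y) (Y y, Z y))
    rw [this.fderiv]; rfl
  have h2 : M.metric (P y) (Y' d) (Z y) = D (0, Y' d, 0) := by
    have hl : HasDerivAt (fun r : ℝ => (P y, Y y + r • Y' d, Z y))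
        ((0 : V), (1 : ℝ) • Y' d, (0 : V)) 0 :=
      (hasDerivAt_const _ _).prodMk
        ((((hasDerivAt_id (0 : ℝ)).smul_const _).const_add _).prodMk (hasDerivAt_const _ _))
    have hm' : HasFDerivAt (fun x : V × V × V => M.metric x.1 x.2.1 x.2.2) D
        (P y, Y y + (0 : ℝ) • Y' d, Z y) := by simpa using hm
    have e1 := hm'.comp_hasDerivAt (0 : ℝ) hl
    have e2 : HasDerivAt (fun r : ℝ => M.metric (P y) (Y y) (Z y)
        + r * M.metric (P y) (Y' d) (Z y)) (1 * M.metric (P y) (Y' d) (Z y)) 0 :=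
      ((hasDerivAt_id (0 : ℝ)).mul_const _).const_add _
    have := e1.unique (e2.congr_of_eventuallyEq (.of_forall fun r => by
      simp [h.add_left, h.smul_left]))
    simpa using this.symm
  have h3 : M.metric (P y) (Y y) (Z' d) = D (0, 0, Z' d) := by
    have hl : HasDerivAt (fun r : ℝ => (P y, Y y, Z y + r • Z' d))
        ((0 : V), (0 : V), (1 : ℝ) • Z' d) 0 :=
      (hasDerivAt_const _ _).prodMk ((hasDerivAt_const _ _).prodMk
        (((hasDerivAt_id (0 : ℝ)).smul_const _).const_add _))
    have hm' : HasFDerivAt (fun x : V × V × V => M.metric x.1 x.2.1 x.2.2) D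
        (P y, Y y, Z y + (0 : ℝ) • Z' d) := by simpa using hm
    have e1 := hm'.comp_hasDerivAt (0 : ℝ) hl
    have e2 : HasDerivAt (fun r : ℝ => M.metric (P y) (Y y) (Z y)
        + r * M.metric (P y) (Y y) (Z' d)) (1 * M.metric (P y) (Y y) (Z' d)) 0 :=
      ((hasDerivAt_id (0 : ℝ)).mul_const _).const_add _
    have := e1.unique (e2.congr_of_eventuallyEq (.of_forall fun r => by
      simp [h.add_right, h.smul_right]))
    simpa using this.symm
  rw [h1, h2, h3, ← map_add, ← map_add]
  simp

/-- The Levi-Civita connection is metric. -/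
theorem hasDerivWithinAt (h : M.IsDifferentiableMetric) {γ Y Z : ℝ → V} {γ' Y' Z' : V}
    {s : Set ℝ} {t : ℝ} (hmem : γ t ∈ M.carrier) (hγ : HasDerivWithinAt γ γ' s t)
    (hY : HasDerivWithinAt Y Y' s t) (hZ : HasDerivWithinAt Z Z' s t) :
    HasDerivWithinAt (fun r => M.metric (γ r) (Y r) (Z r))
      (M.covInner (γ t) γ' (Y t) Y' (Z t) + M.covInner (γ t) γ' (Z t) Z' (Y t)) s t := by
  obtain ⟨L, hL, hLd⟩ := h.hasFDerivWithinAt hmem hγ.hasFDerivWithinAt hY.hasFDerivWithinAt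
    hZ.hasFDerivWithinAt
  refine hL.hasDerivWithinAt.congr_deriv ?_
  rw [hLd]
  have e : (fun x => M.metric x (Z t) (Y t)) = fun x => M.metric x (Y t) (Z t) :=
    funext fun x => h.symm x _ _
  simp only [covInner, christoffel, ContinuousLinearMap.toSpanSingleton_apply, one_smul, e,
    h.symm _ (Y t) Z']
  ring

/-- The acceleration of a curve in the image of a map `f` into `M`, in the directions tangent to
that image, is determined by the metric `g` induced by `f`: it is given by the Christoffel symbols
of the first kind of `g`. -/
theorem accelInner_eq_of_eventuallyEq_comp {F : Type*} [NormedAddCommGroup F] [NormedSpace ℝ F]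
    (h : M.IsDifferentiableMetric) {f : F → V} {R : Set F} {x : ℝ → F} {γ : ℝ → V} {s : Set ℝ}
    {t : ℝ} (hR : UniqueDiffOn ℝ R) (hxR : x t ∈ R) (hxi : x t ∈ closure (interior R))
    (hmem : f (x t) ∈ M.carrier) (hf : ContDiffWithinAt ℝ 2 f R (x t))
    (hs : UniqueDiffOn ℝ s) (hts : t ∈ s) (hx : ContDiffWithinAt ℝ 2 x s t)
    (hmaps : ∀ᶠ r in 𝓝[s] t, x r ∈ R) (hγ : γ =ᶠ[𝓝[s] t] f ∘ x) (w : F) :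
    M.accelInner γ s t (fderivWithin ℝ f R (x t) w) =
      M.metric (f (x t)) (fderivWithin ℝ f R (x t) (derivWithin (derivWithin x s) s t))
        (fderivWithin ℝ f R (x t) w)
      + fderivWithin ℝ (fun y => M.metric (f y) (fderivWithin ℝ f R y (derivWithin x s t))
          (fderivWithin ℝ f R y w)) R (x t) (derivWithin x s t)
      - fderivWithin ℝ (fun y => M.metric (f y) (fderivWithin ℝ f R y (derivWithin x s t))
          (fderivWithin ℝ f R y (derivWithin x s t))) R (x t) w / 2 := by
  set f' := fderivWithin ℝ f R
  set x' := derivWithin x s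
  have hγt : γ t = f (x t) := hγ.eq_of_nhdsWithin hts
  have htend : Filter.Tendsto x (𝓝[s] t) (𝓝[R] x t) :=
    tendsto_nhdsWithin_iff.2 ⟨hx.continuousWithinAt, hmaps⟩
  -- the first derivative near `t`
  have hfd : ∀ᶠ y in 𝓝[R] x t, HasFDerivWithinAt f (f' y) R y := by
    have := hf.eventually (by simp)
    rw [insert_eq_of_mem hxR] at this
    filter_upwards [this] with y hy
    exact (hy.differentiableWithinAt (by simp)).hasFDerivWithinAt
  have hxd : ∀ᶠ r in 𝓝[s] t, HasDerivWithinAt x (x' r) s r := by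
    have := hx.eventually (by simp)
    rw [insert_eq_of_mem hts] at this
    filter_upwards [this] with y hy
    exact (hy.differentiableWithinAt (by simp)).hasDerivWithinAt
  have hγ' : derivWithin γ s =ᶠ[𝓝[s] t] fun r => f' (x r) (x' r) := by
    filter_upwards [htend.eventually hfd, hxd, eventually_eventually_nhdsWithin.2 hγ,
      eventually_eventually_nhdsWithin.2 hmaps, self_mem_nhdsWithin] with r h1 h2 h3 h4 h5
    have h6 : HasDerivWithinAt (f ∘ x) (f' (x r) (x' r)) s r := by
      have h7 : HasFDerivWithinAt f (f' (x r)) R (x r) := h1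
      have h8 := h7.comp_of_tendsto r h2.hasFDerivWithinAt
        (tendsto_nhdsWithin_iff.2 ⟨h2.continuousWithinAt, h4⟩)
      simpa using h8.hasDerivWithinAt
    exact (h6.congr_of_eventuallyEq_of_mem h3 h5).derivWithin (hs r h5)
  -- the second derivative at `t`
  have hf'' : HasFDerivWithinAt f' (fderivWithin ℝ f' R (x t)) R (x t) :=
    ((hf.fderivWithin_right (m := 1) hR (by norm_num) hxR).differentiableWithinAt
      (by simp)).hasFDerivWithinAt
  set f'' := fderivWithin ℝ f' R (x t)
  have hx'' : HasDerivWithinAt x' (derivWithin x' s t) s t := by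
    have := (hx.fderivWithin_right (m := 1) hs (by norm_num) hts).differentiableWithinAt (by simp)
    have := this.clm_apply (differentiableWithinAt_const (1 : ℝ))
    exact (this.congr (fun _ _ => by simp [x', derivWithin])
      (by simp [x', derivWithin])).hasDerivWithinAt
  have hsymm : ∀ u v, f'' u v = f'' v u :=
    hf.isSymmSndFDerivWithinAt (by simp) hR hxi hxR
  have hxt : HasDerivWithinAt x (x' t) s t := hxd.self_of_nhdsWithin hts
  have hft : HasFDerivWithinAt f (f' (x t)) R (x t) := hfd.self_of_nhdsWithin hxR
  have hγ'' : derivWithin (fun r => derivWithin γ s r) s t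
      = f'' (x' t) (x' t) + f' (x t) (derivWithin x' s t) := by
    have h1 : HasDerivWithinAt (fun r => f' (x r)) (f'' (x' t)) s t := by
      have h0 : HasFDerivWithinAt f' f'' R (x t) := hf''
      have h3 := (h0.comp_of_tendsto t hxt.hasFDerivWithinAt htend).hasDerivWithinAt
      exact h3.congr_deriv (by simp)
    have h2 := h1.clm_apply hx''
    exact (h2.congr_of_eventuallyEq_of_mem hγ' hts).derivWithin (hs t hts)
  -- the derivatives of the induced metric
  have happ : ∀ u, HasFDerivWithinAt (fun y => f' y u) (f''.flip u) R (x t) := by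
    intro u
    have := hf''.clm_apply (hasFDerivWithinAt_const u (x t) R)
    refine this.congr_fderiv ?_
    ext; simp
  obtain ⟨L, hL, hLd⟩ := h.hasFDerivWithinAt hmem hft (happ (x' t)) (happ w)
  obtain ⟨L', hL', hLd'⟩ := h.hasFDerivWithinAt hmem hft (happ (x' t)) (happ (x' t))
  rw [hL.fderivWithin (hR _ hxR), hL'.fderivWithin (hR _ hxR), hLd, hLd', accelInner, covInner,
    christoffel, hγ'', hγ'.self_of_nhdsWithin hts, hγt, h.add_left]
  simp only [ContinuousLinearMap.flip_apply, hsymm w (x' t),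
    h.symm _ (f'' (x' t) w) (f' (x t) (x' t))]
  ring

end IsDifferentiableMetric

end EmbeddedRiemannian

/-! ### The homogeneous spaces as regular models -/

theorem det4_apply (a b c d : AmbientSpace) : det4 a b c d =
    a.2 * (b.1 0 * (c.1 2 * d.1 1 - c.1 1 * d.1 2) + b.1 1 * (c.1 0 * d.1 2 - c.1 2 * d.1 0)
        + b.1 2 * (c.1 1 * d.1 0 - c.1 0 * d.1 1))
    - b.2 * (a.1 0 * (c.1 2 * d.1 1 - c.1 1 * d.1 2) + a.1 1 * (c.1 0 * d.1 2 - c.1 2 * d.1 0)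
        + a.1 2 * (c.1 1 * d.1 0 - c.1 0 * d.1 1))
    + c.2 * (a.1 0 * (b.1 2 * d.1 1 - b.1 1 * d.1 2) + a.1 1 * (b.1 0 * d.1 2 - b.1 2 * d.1 0)
        + a.1 2 * (b.1 1 * d.1 0 - b.1 0 * d.1 1))
    - d.2 * (a.1 0 * (b.1 2 * c.1 1 - b.1 1 * c.1 2) + a.1 1 * (b.1 0 * c.1 2 - b.1 2 * c.1 0)
        + a.1 2 * (b.1 1 * c.1 0 - b.1 0 * c.1 1)) := by
  simp [det4, coords, Matrix.det_succ_row_zero, Fin.sum_univ_succ, Fin.succAbove]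
  ring

namespace OrientedModel

/-- The properties shared by the models of `𝔼(κ, τ)`: the metric is differentiable, the model
lies in a level set of a function whose differential has the tangent spaces as kernels, `ξ` is a unit
tangent field, and `vol` is a determinant. -/
structure IsRegular (E : OrientedModel) : Prop where
  metric : E.toEmbeddedRiemannian.IsDifferentiableMetric
  levelSet : ∃ F : AmbientSpace → ℝ, (∀ p ∈ E.carrier, F p = 0) ∧ ∀ p ∈ E.carrier,
    DifferentiableAt ℝ F p ∧ ∀ u, u ∈ E.tangent p ↔ fderiv ℝ F p u = 0
  xi_mem : ∀ p ∈ E.carrier, E.ξ p ∈ E.tangent p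
  xi_unit : ∀ p ∈ E.carrier, E.metric p (E.ξ p) (E.ξ p) = 1
  vol_eq_det : ∃ (r : AmbientSpace → ℝ) (n : AmbientSpace → AmbientSpace), ∀ p u v w,
    E.vol p u v w = r p * det4 u v (n p) w

namespace IsRegular

variable {E : OrientedModel}

theorem add_mem (h : E.IsRegular) {p u v : AmbientSpace} (hp : p ∈ E.carrier)
    (hu : u ∈ E.tangent p) (hv : v ∈ E.tangent p) : u + v ∈ E.tangent p := by
  obtain ⟨F, -, hF⟩ := h.levelSet
  rw [(hF p hp).2] at *
  rw [map_add, hu, hv, add_zero]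

theorem smul_mem (h : E.IsRegular) {p u : AmbientSpace} (r : ℝ) (hp : p ∈ E.carrier)
    (hu : u ∈ E.tangent p) : r • u ∈ E.tangent p := by
  obtain ⟨F, -, hF⟩ := h.levelSet
  rw [(hF p hp).2] at *
  rw [map_smul, hu, smul_zero]

theorem sub_mem (h : E.IsRegular) {p u v : AmbientSpace} (hp : p ∈ E.carrier)
    (hu : u ∈ E.tangent p) (hv : v ∈ E.tangent p) : u - v ∈ E.tangent p := by
  rw [sub_eq_add_neg, ← neg_one_smul ℝ v]
  exact h.add_mem hp hu (h.smul_mem _ hp hv)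

theorem vol_rotate (h : E.IsRegular) (p u v w : AmbientSpace) (a b : ℝ) :
    E.vol p (a • w + b • v) u v = a * E.vol p u v w := by
  obtain ⟨r, n, hv⟩ := h.vol_eq_det
  simp only [hv, det4_apply, Prod.fst_add, Prod.snd_add, Prod.smul_fst, Prod.smul_snd,
    Pi.add_apply, Pi.smul_apply, smul_eq_mul]
  ring

theorem vol_rotated_frame (h : E.IsRegular) (p u v w : AmbientSpace) (a b : ℝ) :
    E.vol p u (a • v + b • w) (a • w - b • v) = (a ^ 2 + b ^ 2) * E.vol p w u v := by
  obtain ⟨r, n, hv⟩ := h.vol_eq_det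
  simp only [hv, det4_apply, Prod.fst_add, Prod.snd_add, Prod.fst_sub, Prod.snd_sub,
    Prod.smul_fst, Prod.smul_snd, Pi.add_apply, Pi.sub_apply, Pi.smul_apply, smul_eq_mul]
  ring

theorem vol_self (h : E.IsRegular) (p u v : AmbientSpace) : E.vol p u v v = 0 := by
  obtain ⟨r, n, hv⟩ := h.vol_eq_det
  simp only [hv, det4_apply]
  ring

end IsRegular

theorem hasFDerivAt_sq_add_sq_add (κ : ℝ) (p : AmbientSpace) :
    ∃ L : AmbientSpace →L[ℝ] ℝ, HasFDerivAt
      (fun p : AmbientSpace => p.1 0 ^ 2 + p.1 1 ^ 2 + κ * p.1 2 ^ 2 - 2 * p.1 2) L p ∧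
      ∀ u, L u = 2 * conormalForm κ p.1 u.1 := by
  have hc : ∀ i : Fin 3, HasFDerivAt (fun p : AmbientSpace => p.1 i)
      ((ContinuousLinearMap.proj i).comp (ContinuousLinearMap.fst ℝ (Fin 3 → ℝ) ℝ)) p := fun i =>
    ((ContinuousLinearMap.proj (R := ℝ) (φ := fun _ : Fin 3 => ℝ) i).comp
      (ContinuousLinearMap.fst ℝ (Fin 3 → ℝ) ℝ)).hasFDerivAt
  refine ⟨_, ((((hc 0).pow 2).add ((hc 1).pow 2)).add (((hc 2).pow 2).const_mul κ)).sub
    ((hc 2).const_mul 2), fun u => ?_⟩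
  simp [conormalForm]
  ring

theorem isRegular_productSpace (κ : ℝ) : (productSpace κ).IsRegular where
  metric :=
    { add_left := fun p u u' v => by
        simp only [metric_productSpace, Prod.fst_add, Prod.snd_add, modelForm_add_left]; ring
      smul_left := fun p r u v => by
        simp only [metric_productSpace, Prod.smul_fst, Prod.smul_snd, modelForm_smul_left,
          smul_eq_mul]; ring
      symm := fun p u v => by
        simp only [metric_productSpace]; rw [modelForm_comm, mul_comm]
      differentiable := fun p _ u v => by
        simp only [metric_productSpace, modelForm]; fun_prop }
  levelSet := by
    refine ⟨fun p : AmbientSpace => p.1 0 ^ 2 + p.1 1 ^ 2 + κ * p.1 2 ^ 2 - 2 * p.1 2,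
      fun p hp => by have := hp.1; linarith, fun p _ => ?_⟩
    obtain ⟨L, hL, hLu⟩ := hasFDerivAt_sq_add_sq_add κ p
    refine ⟨hL.differentiableAt, fun u => ?_⟩
    rw [hL.fderiv, hLu, mem_tangent_productSpace]
    simp
  xi_mem p _ := by simp [productSpace, modelSurface]
  xi_unit p _ := by simp [productSpace, modelSurface]
  vol_eq_det := ⟨fun _ => 1, fun p => (modelNormal κ p.1, 0), fun p u v w => (one_mul _).symm⟩

theorem isRegular_cartanModel (κ τ : ℝ) : (cartanModel κ τ).IsRegular where
  metric :=
    { add_left := fun p u u' v => by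
        simp only [cartanModel, cartanForm, Prod.fst_add, Prod.snd_add, Pi.add_apply]; ring
      smul_left := fun p r u v => by
        simp only [cartanModel, cartanForm, Prod.smul_fst, Prod.smul_snd, Pi.smul_apply,
          smul_eq_mul]; ring
      symm := fun p u v => by simp only [cartanModel]; ring
      differentiable := fun p hp u v => by
        have hne : 1 + κ / 4 * (p.1 0 ^ 2 + p.1 1 ^ 2) ≠ 0 := by
          intro h0
          have := hp.2
          simp [cartanFactor, h0] at this
        simp only [cartanModel, cartanForm, cartanFactor]
        fun_prop (disch := exact hne) }
  levelSet := by
    refine ⟨fun p => p.1 2, fun p hp => hp.1, fun p _ => ?_⟩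
    have h : HasFDerivAt (fun p : AmbientSpace => p.1 2)
        ((ContinuousLinearMap.proj 2).comp (ContinuousLinearMap.fst ℝ (Fin 3 → ℝ) ℝ)) p :=
      ((ContinuousLinearMap.proj (R := ℝ) (φ := fun _ : Fin 3 => ℝ) 2).comp
        (ContinuousLinearMap.fst ℝ (Fin 3 → ℝ) ℝ)).hasFDerivAt
    refine ⟨h.differentiableAt, fun u => ?_⟩
    rw [h.fderiv]
    rfl
  xi_mem p _ := by simp [cartanModel]
  xi_unit p _ := by simp [cartanModel, cartanForm]
  vol_eq_det := ⟨fun p => cartanFactor κ p ^ 2, fun p => (![0, 0, 1], 0), fun p u v w => rfl⟩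

theorem isRegular_bergerSphere {κ τ : ℝ} (hκ : 0 < κ) (hτ : τ ≠ 0) :
    (bergerSphere κ τ).IsRegular where
  metric :=
    { add_left := fun p u u' v => by
        simp only [bergerSphere, euclDot, Prod.fst_add, Prod.snd_add, Pi.add_apply]; ring
      smul_left := fun p r u v => by
        simp only [bergerSphere, euclDot, Prod.smul_fst, Prod.smul_snd, Pi.smul_apply,
          smul_eq_mul]; ring
      symm := fun p u v => by simp only [bergerSphere, euclDot]; ring
      differentiable := fun p hp u v => by
        simp only [bergerSphere, euclDot, hopfField, Prod.smul_fst, Prod.smul_snd, Pi.smul_apply,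
          smul_eq_mul, Matrix.cons_val]
        fun_prop }
  levelSet := by
    refine ⟨fun p => euclDot p p - 1, fun p hp => sub_eq_zero.2 hp, fun p _ => ?_⟩
    have hc : ∀ i : Fin 3, HasFDerivAt (fun p : AmbientSpace => p.1 i)
        ((ContinuousLinearMap.proj i).comp (ContinuousLinearMap.fst ℝ (Fin 3 → ℝ) ℝ)) p := fun i =>
      ((ContinuousLinearMap.proj (R := ℝ) (φ := fun _ : Fin 3 => ℝ) i).comp
        (ContinuousLinearMap.fst ℝ (Fin 3 → ℝ) ℝ)).hasFDerivAt
    have h2 : HasFDerivAt (fun p : AmbientSpace => p.2)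
        (ContinuousLinearMap.snd ℝ (Fin 3 → ℝ) ℝ) p := hasFDerivAt_snd
    have h : HasFDerivAt (fun p => euclDot p p - 1) _ p :=
      (((((hc 0).mul (hc 0)).add ((hc 1).mul (hc 1))).add ((hc 2).mul (hc 2))).add
        (h2.mul h2)).sub_const 1
    refine ⟨h.differentiableAt, fun u => ?_⟩
    rw [h.fderiv]
    change euclDot p u = 0 ↔ _
    have e : ∀ x y : ℝ, y = 2 * x → (x = 0 ↔ y = 0) := fun x y hxy => by rw [hxy]; simp
    apply e
    simp [euclDot]
    ring
  xi_mem p _ := by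
    change euclDot p (hopfField κ τ p) = 0
    simp [euclDot, hopfField]
    ring
  xi_unit p hp := by
    have hp' : euclDot p p = 1 := hp
    have h : euclDot (hopfField κ τ p) (hopfField κ τ p) = (κ / (4 * τ)) ^ 2 := by
      simp only [euclDot] at hp'
      simp [euclDot, hopfField]
      linear_combination (κ / (4 * τ)) ^ 2 * hp'
    change 4 / κ * (euclDot (hopfField κ τ p) (hopfField κ τ p) + _ *
      (euclDot (hopfField κ τ p) (hopfField κ τ p) * euclDot (hopfField κ τ p) (hopfField κ τ p)))
      = 1
    rw [h]
    field_simp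
    ring
  vol_eq_det := ⟨fun _ => -(16 * τ / κ ^ 2), fun p => p, fun p u v w => rfl⟩

theorem isRegular_Ekt (κ τ : ℝ) : (Ekt κ τ).IsRegular := by
  unfold Ekt
  split_ifs with h1 h2
  · exact isRegular_productSpace κ
  · exact isRegular_bergerSphere h2 h1
  · exact isRegular_cartanModel κ τ

end OrientedModel

/-! ### The cross product of the product space -/

/-- The cross product of `𝕄²(κ) × ℝ`. -/
def productCross (κ : ℝ) (p u v : AmbientSpace) : AmbientSpace :=
  (u.2 • modelRotation κ p.1 v.1 - v.2 • modelRotation κ p.1 u.1, areaForm κ p.1 u.1 v.1)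

section ProductCross

variable {κ : ℝ} {p u v w : AmbientSpace}

theorem metric_productCross :
    (productSpace κ).metric p (productCross κ p u v) w = (productSpace κ).vol p u v w := by
  change _ = det4 u v (modelNormal κ p.1, 0) w
  simp only [metric_productSpace, productCross, modelForm_sub_left, modelForm_smul_left,
    modelForm_modelRotation, areaForm, det4_apply, modelNormal_zero, modelNormal_one,
    modelNormal_two]
  ring

theorem productCross_mem_tangent : productCross κ p u v ∈ (productSpace κ).tangent p := by
  rw [mem_tangent_productSpace, productCross, conormalForm_sub, conormalForm_smul,
    conormalForm_smul, conormalForm_modelRotation, conormalForm_modelRotation]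
  ring

theorem metric_productCross_self (hp : p ∈ (productSpace κ).carrier)
    (hu : u ∈ (productSpace κ).tangent p) (hv : v ∈ (productSpace κ).tangent p) :
    (productSpace κ).metric p (productCross κ p u v) (productCross κ p u v) =
      (productSpace κ).metric p u u * (productSpace κ).metric p v v
        - (productSpace κ).metric p u v ^ 2 := by
  have hp' : p.1 ∈ (modelSurface κ).carrier := hp
  rw [mem_tangent_productSpace] at hu hv
  have h := areaForm_sq hp' hu hv
  simp only [metric_productSpace, productCross, modelForm_sub_left, modelForm_smul_left,
    modelForm_sub_right, modelForm_smul_right, modelForm_modelRotation_modelRotation hp' hu,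
    modelForm_modelRotation_modelRotation hp' hv, modelForm_comm (u := v.1) (v := u.1)]
  linear_combination h

theorem eq_of_metric_eq (hp : p ∈ (productSpace κ).carrier)
    (hu : u ∈ (productSpace κ).tangent p) (hv : v ∈ (productSpace κ).tangent p)
    (h : ∀ w ∈ (productSpace κ).tangent p,
      (productSpace κ).metric p u w = (productSpace κ).metric p v w) : u = v := by
  rw [mem_tangent_productSpace] at hu hv
  have h1 : u.1 - v.1 = 0 := by
    apply eq_zero_of_orthogonal_tangent (κ := κ) (q := p.1) hp
    · rw [conormalForm_sub, hu, hv, sub_zero]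
    · intro w hw
      have := h (w, 0) hw
      simp only [metric_productSpace, mul_zero, add_zero] at this
      rw [modelForm_sub_left, this, sub_self]
  have h2 : u.2 = v.2 := by
    have := h (0, 1) (by simp [mem_tangent_productSpace, conormalForm])
    simpa [metric_productSpace, modelForm] using this
  exact Prod.ext (sub_eq_zero.1 h1) h2

end ProductCross

/-! ### Immersed surfaces and curves on them -/

section Surfaces

variable {HS S : Type*} [TopologicalSpace HS] [TopologicalSpace S]
  {I : ModelWithCorners ℝ (EuclideanSpace ℝ (Fin 2)) HS} [ChartedSpace HS S]

/-- The velocity vector at time `t` of a curve on the surface, defined on `[0, ℓ]`. -/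
noncomputable def curveVelocity (I : ModelWithCorners ℝ (EuclideanSpace ℝ (Fin 2)) HS) (α : ℝ → S)
    (ℓ t : ℝ) : TangentSpace I (α t) :=
  mfderivWithin 𝓘(ℝ, ℝ) I α (Icc 0 ℓ) t (1 : ℝ)

theorem contDiffOn_comp_curve {f : S → AmbientSpace} {α : ℝ → S} {ℓ : ℝ}
    (hf : ContMDiff I 𝓘(ℝ, AmbientSpace) ∞ f) (hα : ContMDiffOn 𝓘(ℝ, ℝ) I ∞ α (Icc 0 ℓ)) :
    ContDiffOn ℝ ∞ (f ∘ α) (Icc 0 ℓ) :=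
  contMDiffOn_iff_contDiffOn.1 (hf.comp_contMDiffOn hα)

theorem hasDerivWithinAt_comp_curve {f : S → AmbientSpace} {α : ℝ → S} {ℓ t : ℝ} (hℓ : 0 < ℓ)
    (hf : ContMDiff I 𝓘(ℝ, AmbientSpace) ∞ f) (hα : ContMDiffOn 𝓘(ℝ, ℝ) I ∞ α (Icc 0 ℓ))
    (ht : t ∈ Icc 0 ℓ) :
    HasDerivWithinAt (f ∘ α) (surfaceDiff I f (α t) (curveVelocity I α ℓ t)) (Icc 0 ℓ) t := by
  have h1 := ((contDiffOn_comp_curve hf hα).differentiableOn (by simp) t ht).hasDerivWithinAt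
  refine h1.congr_deriv ?_
  have h2 := mfderiv_comp_mfderivWithin (I := 𝓘(ℝ, ℝ)) (I' := I) (I'' := 𝓘(ℝ, AmbientSpace)) t
    ((hf (α t)).mdifferentiableAt (by simp)) ((hα t ht).mdifferentiableWithinAt (by simp))
    ((uniqueDiffOn_Icc hℓ).uniqueMDiffOn t ht)
  rw [mfderivWithin_eq_fderivWithin] at h2
  rw [derivWithin, h2]
  rfl

/-- Two maps that induce the same metric on the surface also induce the same geodesic curvature: the
accelerations of the images of a curve have the same tangential components. -/
theorem accelInner_comp_curve_eq [IsManifold I ∞ S] {M₁ M₂ : EmbeddedRiemannian AmbientSpace}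
    (hM₁ : M₁.IsDifferentiableMetric) (hM₂ : M₂.IsDifferentiableMetric)
    {f₁ f₂ : S → AmbientSpace} (hf₁ : ContMDiff I 𝓘(ℝ, AmbientSpace) ∞ f₁)
    (hf₂ : ContMDiff I 𝓘(ℝ, AmbientSpace) ∞ f₂) (hmem₁ : ∀ p, f₁ p ∈ M₁.carrier)
    (hmem₂ : ∀ p, f₂ p ∈ M₂.carrier)
    (hmetric : ∀ (p : S) (u v : TangentSpace I p),
      M₁.metric (f₁ p) (surfaceDiff I f₁ p u) (surfaceDiff I f₁ p v) =
        M₂.metric (f₂ p) (surfaceDiff I f₂ p u) (surfaceDiff I f₂ p v))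
    {α : ℝ → S} {ℓ t : ℝ} (hℓ : 0 < ℓ) (hα : ContMDiffOn 𝓘(ℝ, ℝ) I ∞ α (Icc 0 ℓ))
    (ht : t ∈ Icc 0 ℓ) (v : TangentSpace I (α t)) :
    M₁.accelInner (f₁ ∘ α) (Icc 0 ℓ) t (surfaceDiff I f₁ (α t) v) =
      M₂.accelInner (f₂ ∘ α) (Icc 0 ℓ) t (surfaceDiff I f₂ (α t) v) := by
  set ch := extChartAt I (α t)
  set x : ℝ → EuclideanSpace ℝ (Fin 2) := ch ∘ α
  have hxR : x t ∈ range I := extChartAt_target_subset_range (α t) (mem_extChartAt_target (α t))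
  have hx : ContDiffWithinAt ℝ 2 x (Icc 0 ℓ) t := by
    have h := (contMDiffAt_extChartAt (n := ∞) (I := I) (x := α t)).comp_contMDiffWithinAt t
      (hα t ht)
    exact (contMDiffWithinAt_iff_contDiffWithinAt.1 h).of_le (by norm_cast)
  have hsource : ∀ᶠ r in 𝓝[Icc 0 ℓ] t, α r ∈ ch.source :=
    (hα t ht).continuousWithinAt.eventually (extChartAt_source_mem_nhds (α t))
  have hmaps : ∀ᶠ r in 𝓝[Icc 0 ℓ] t, x r ∈ range I := hsource.mono fun r hr =>
    extChartAt_target_subset_range (α t) (ch.map_source hr)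
  have hloc : ∀ f : S → AmbientSpace, f ∘ α =ᶠ[𝓝[Icc 0 ℓ] t] (f ∘ ch.symm) ∘ x := fun f =>
    hsource.mono fun r hr => by simp only [x, Function.comp_apply, ch.left_inv hr]
  have hbase : ∀ f : S → AmbientSpace, (f ∘ ch.symm) (x t) = f (α t) := fun f =>
    congrArg f (extChartAt_to_inv (I := I) (α t))
  have hsmooth : ∀ f : S → AmbientSpace, ContMDiff I 𝓘(ℝ, AmbientSpace) ∞ f →
      ContDiffWithinAt ℝ 2 (f ∘ ch.symm) (range I) (x t) := fun f hf =>
    (contMDiffAt_iff.1 (hf (α t))).2.of_le (by norm_cast)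
  have hdiff : ∀ f : S → AmbientSpace, ContMDiff I 𝓘(ℝ, AmbientSpace) ∞ f → ∀ v,
      fderivWithin ℝ (f ∘ ch.symm) (range I) (x t) v = surfaceDiff I f (α t) v := by
    intro f hf v
    exact (congrArg (fun L => L v) ((hf (α t)).mdifferentiableAt (by simp)).mfderiv).symm
  have hchain : ∀ f : S → AmbientSpace, ContMDiff I 𝓘(ℝ, AmbientSpace) ∞ f →
      ∀ y ∈ ch.target, ∀ u, fderivWithin ℝ (f ∘ ch.symm) (range I) y u =
        surfaceDiff I f (ch.symm y) (mfderivWithin 𝓘(ℝ, EuclideanSpace ℝ (Fin 2)) I ch.symm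
          (range I) y u) := by
    intro f hf y hy u
    have h := mfderiv_comp_mfderivWithin (I := 𝓘(ℝ, EuclideanSpace ℝ (Fin 2))) (I' := I)
      (I'' := 𝓘(ℝ, AmbientSpace)) y ((hf (ch.symm y)).mdifferentiableAt (by simp))
      (mdifferentiableWithinAt_extChartAt_symm hy)
      (I.uniqueDiffOn.uniqueMDiffOn y (extChartAt_target_subset_range (α t) hy))
    rw [mfderivWithin_eq_fderivWithin] at h
    rw [h]
    rfl
  -- the two induced metrics agree in the chart
  have hpull : ∀ y ∈ ch.target, ∀ u v,
      M₁.metric ((f₁ ∘ ch.symm) y) (fderivWithin ℝ (f₁ ∘ ch.symm) (range I) y u)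
        (fderivWithin ℝ (f₁ ∘ ch.symm) (range I) y v) =
      M₂.metric ((f₂ ∘ ch.symm) y) (fderivWithin ℝ (f₂ ∘ ch.symm) (range I) y u)
        (fderivWithin ℝ (f₂ ∘ ch.symm) (range I) y v) := by
    intro y hy u v
    rw [hchain f₁ hf₁ y hy, hchain f₁ hf₁ y hy, hchain f₂ hf₂ y hy, hchain f₂ hf₂ y hy]
    exact hmetric _ _ _
  have hpull' : ∀ u v, fderivWithin ℝ (fun y =>
      M₁.metric ((f₁ ∘ ch.symm) y) (fderivWithin ℝ (f₁ ∘ ch.symm) (range I) y u)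
        (fderivWithin ℝ (f₁ ∘ ch.symm) (range I) y v)) (range I) (x t) =
      fderivWithin ℝ (fun y =>
      M₂.metric ((f₂ ∘ ch.symm) y) (fderivWithin ℝ (f₂ ∘ ch.symm) (range I) y u)
        (fderivWithin ℝ (f₂ ∘ ch.symm) (range I) y v)) (range I) (x t) := fun u v =>
    Filter.EventuallyEq.fderivWithin_eq_of_mem (Filter.mem_of_superset
      (extChartAt_target_mem_nhdsWithin (α t)) fun y hy => hpull y hy u v) hxR
  have key : ∀ v : EuclideanSpace ℝ (Fin 2),
      M₁.accelInner (f₁ ∘ α) (Icc 0 ℓ) t (fderivWithin ℝ (f₁ ∘ ch.symm) (range I) (x t) v) =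
      M₂.accelInner (f₂ ∘ α) (Icc 0 ℓ) t (fderivWithin ℝ (f₂ ∘ ch.symm) (range I) (x t) v) := by
    intro v
    rw [hM₁.accelInner_eq_of_eventuallyEq_comp I.uniqueDiffOn hxR
        (I.range_subset_closure_interior hxR) (by rw [hbase]; exact hmem₁ _) (hsmooth f₁ hf₁)
        (uniqueDiffOn_Icc hℓ) ht hx hmaps (hloc f₁) v,
      hM₂.accelInner_eq_of_eventuallyEq_comp I.uniqueDiffOn hxR
        (I.range_subset_closure_interior hxR) (by rw [hbase]; exact hmem₂ _) (hsmooth f₂ hf₂)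
        (uniqueDiffOn_Icc hℓ) ht hx hmaps (hloc f₂) v,
      hpull', hpull', hpull (x t) (mem_extChartAt_target (α t))]
  rw [← hdiff f₁ hf₁ v, ← hdiff f₂ hf₂ v]
  exact key v

namespace OrientedModel.IsRegular

theorem surfaceDiff_mem_tangent {E : OrientedModel} (hE : E.IsRegular) {f : S → AmbientSpace}
    (hf : ContMDiff I 𝓘(ℝ, AmbientSpace) ∞ f) (hmem : ∀ p, f p ∈ E.carrier) (p : S)
    (v : TangentSpace I p) : surfaceDiff I f p v ∈ E.tangent (f p) := by
  obtain ⟨F, hF0, hF⟩ := hE.levelSet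
  rw [(hF _ (hmem p)).2]
  have h1 := ((hf p).mdifferentiableAt (by simp)).hasMFDerivAt
  have h2 : HasMFDerivAt 𝓘(ℝ, AmbientSpace) 𝓘(ℝ, ℝ) F (f p) (fderiv ℝ F (f p)) :=
    (hF _ (hmem p)).1.hasFDerivAt.hasMFDerivAt
  have h3 := h2.comp p h1
  have h4 : F ∘ f = fun _ => 0 := funext fun q => hF0 _ (hmem q)
  rw [h4] at h3
  have h5 := hasMFDerivAt_unique h3 (hasMFDerivAt_const 0 p)
  exact congrArg (fun L => L v) h5

end OrientedModel.IsRegular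

end Surfaces

/-! ### Calculus on a closed interval -/

theorem exists_contDiffOn_primitive {ℓ : ℝ} (hℓ : 0 < ℓ) {f : ℝ → ℝ}
    (hf : ContDiffOn ℝ ∞ f (Icc 0 ℓ)) : ∃ F : ℝ → ℝ, F 0 = 0 ∧ ContDiffOn ℝ ∞ F (Icc 0 ℓ) ∧
      ∀ t ∈ Icc 0 ℓ, HasDerivWithinAt F (f t) (Icc 0 ℓ) t := by
  have hg : Continuous (IccExtend hℓ.le ((Icc 0 ℓ).domRestrict f)) :=
    (continuousOn_iff_continuous_domRestrict.1 hf.continuousOn).Icc_extend'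
  have hd : ∀ t ∈ Icc 0 ℓ, HasDerivWithinAt
      (fun t => ∫ r in (0 : ℝ)..t, IccExtend hℓ.le ((Icc 0 ℓ).domRestrict f) r) (f t)
      (Icc 0 ℓ) t := by
    intro t ht
    refine (hg.integral_hasStrictDerivAt 0 t).hasDerivAt.hasDerivWithinAt.congr_deriv ?_
    rw [IccExtend_of_mem _ _ ht, domRestrict_apply]
  refine ⟨_, by simp, ?_, hd⟩
  rw [contDiffOn_infty_iff_derivWithin (uniqueDiffOn_Icc hℓ)]
  exact ⟨fun t ht => (hd t ht).differentiableWithinAt,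
    hf.congr fun t ht => (hd t ht).derivWithin (uniqueDiffOn_Icc hℓ t ht)⟩

/-- A curve on a closed interval with nonvanishing derivative at `t` is injective near `t`. -/
theorem exists_injOn_of_derivWithin_ne_zero {ℓ t : ℝ} (hℓ : 0 < ℓ) {f : ℝ → ℝ}
    (hf : ContDiffOn ℝ ∞ f (Icc 0 ℓ)) (ht : t ∈ Icc 0 ℓ) (h : derivWithin f (Icc 0 ℓ) t ≠ 0) :
    ∃ U ∈ 𝓝[Icc 0 ℓ] t, InjOn f U := by
  have hcont : ContinuousWithinAt (derivWithin f (Icc 0 ℓ)) (Icc 0 ℓ) t :=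
    (hf.continuousOn_derivWithin (uniqueDiffOn_Icc hℓ) (by norm_cast)) t ht
  obtain ⟨ε, hε, hU⟩ := Metric.mem_nhdsWithin_iff.1 (hcont.eventually_ne h)
  refine ⟨Metric.ball t ε ∩ Icc 0 ℓ, Filter.inter_mem (mem_nhdsWithin_of_mem_nhds
    (Metric.ball_mem_nhds t hε)) self_mem_nhdsWithin, ?_⟩
  have hconv : OrdConnected (Metric.ball t ε ∩ Icc 0 ℓ) := by
    rw [Real.ball_eq_Ioo]
    infer_instance
  -- two equal values would give a critical point in between
  have key : ∀ x ∈ Metric.ball t ε ∩ Icc 0 ℓ, ∀ y ∈ Metric.ball t ε ∩ Icc 0 ℓ, f x = f y →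
      ¬ x < y := by
    intro x hx y hy hxy hlt
    have hsub : Icc x y ⊆ Metric.ball t ε ∩ Icc 0 ℓ := hconv.out hx hy
    obtain ⟨z, hz, hz0⟩ := exists_deriv_eq_zero hlt
      (hf.continuousOn.mono fun r hr => (hsub hr).2) hxy
    have hzU := hsub (Ioo_subset_Icc_self hz)
    have hnhds : Icc (0 : ℝ) ℓ ∈ 𝓝 z :=
      Icc_mem_nhds (hx.2.1.trans_lt hz.1) (hz.2.trans_le hy.2.2)
    exact hU hzU (by rw [derivWithin_of_mem_nhds hnhds, hz0])
  intro x hx y hy hxy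
  exact le_antisymm (not_lt.1 (key y hy x hx hxy.symm)) (not_lt.1 (key x hx y hy hxy))

theorem deriv_eq_zero_of_const_on {ℓ t d r : ℝ} (hℓ : 0 < ℓ) {f : ℝ → ℝ} (ht : t ∈ Icc 0 ℓ)
    (hd : HasDerivWithinAt f d (Icc 0 ℓ) t) (hf : ∀ x ∈ Icc 0 ℓ, f x = r) : d = 0 :=
  (uniqueDiffOn_Icc hℓ t ht).eq_deriv _ hd
    ((hasDerivWithinAt_const t (Icc 0 ℓ) r).congr hf (hf t ht))

theorem eq_initial_of_hasDerivWithinAt_zero {V : Type*} [NormedAddCommGroup V] [NormedSpace ℝ V]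
    {ℓ t : ℝ} {f : ℝ → V} (hf : ∀ x ∈ Icc 0 ℓ, HasDerivWithinAt f 0 (Icc 0 ℓ) x)
    (hℓ : 0 < ℓ) (ht : t ∈ Icc 0 ℓ) : f t = f 0 :=
  constant_of_derivWithin_zero (fun x hx => (hf x hx).differentiableWithinAt)
    (fun x hx => (hf x (Ico_subset_Icc_self hx)).derivWithin
      (uniqueDiffOn_Icc hℓ x (Ico_subset_Icc_self hx))) t ht

section ProductRules

variable {κ : ℝ} {s : Set ℝ} {t : ℝ}

theorem hasDerivWithinAt_fst {Y : ℝ → AmbientSpace} {Y' : AmbientSpace}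
    (hY : HasDerivWithinAt Y Y' s t) : HasDerivWithinAt (fun r => (Y r).1) Y'.1 s t := hY.fst

theorem hasDerivWithinAt_snd {Y : ℝ → AmbientSpace} {Y' : AmbientSpace}
    (hY : HasDerivWithinAt Y Y' s t) : HasDerivWithinAt (fun r => (Y r).2) Y'.2 s t := hY.snd

theorem differentiableWithinAt_modelRotation {q v : ℝ → Fin 3 → ℝ}
    (hq : DifferentiableWithinAt ℝ q s t) (hv : DifferentiableWithinAt ℝ v s t) :
    DifferentiableWithinAt ℝ (fun r => modelRotation κ (q r) (v r)) s t := by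
  have g := differentiableWithinAt_pi.1 hq
  have w := differentiableWithinAt_pi.1 hv
  refine differentiableWithinAt_pi.2 fun i => ?_
  fin_cases i
  · exact (((g 1).const_mul (-κ)).mul (w 2)).sub ((((g 2).const_mul κ).const_sub 1).mul (w 1))
  · exact ((((g 2).const_mul κ).const_sub 1).mul (w 0)).add (((g 0).const_mul κ).mul (w 2))
  · exact ((g 1).mul (w 0)).sub ((g 0).mul (w 1))

theorem hasDerivWithinAt_modelForm {u v : ℝ → Fin 3 → ℝ} {u' v' : Fin 3 → ℝ}
    (hu : HasDerivWithinAt u u' s t) (hv : HasDerivWithinAt v v' s t) :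
    HasDerivWithinAt (fun r => modelForm κ (u r) (v r))
      (modelForm κ u' (v t) + modelForm κ (u t) v') s t := by
  have h1 := hasDerivWithinAt_pi.1 hu
  have h2 := hasDerivWithinAt_pi.1 hv
  refine ((((h1 0).mul (h2 0)).add ((h1 1).mul (h2 1))).add
    (((h1 2).mul (h2 2)).const_mul κ)).congr_deriv ?_
  simp only [modelForm]
  ring

theorem hasDerivWithinAt_conormalForm {q u : ℝ → Fin 3 → ℝ} {q' u' : Fin 3 → ℝ}
    (hq : HasDerivWithinAt q q' s t) (hu : HasDerivWithinAt u u' s t) :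
    HasDerivWithinAt (fun r => conormalForm κ (q r) (u r))
      (modelForm κ q' (u t) + conormalForm κ (q t) u') s t := by
  have h1 := hasDerivWithinAt_pi.1 hq
  have h2 := hasDerivWithinAt_pi.1 hu
  refine ((((h1 0).mul (h2 0)).add ((h1 1).mul (h2 1))).add
    ((((h1 2).const_mul κ).sub_const 1).mul (h2 2))).congr_deriv ?_
  simp only [modelForm, conormalForm]
  ring

theorem hasDerivWithinAt_modelNormal {q : ℝ → Fin 3 → ℝ} {q' : Fin 3 → ℝ}
    (hq : HasDerivWithinAt q q' s t) :
    HasDerivWithinAt (fun r => modelNormal κ (q r)) (-κ • q') s t := by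
  have e : (fun r => modelNormal κ (q r)) = fun r => ![0, 0, 1] + -κ • q r := by
    funext r i
    fin_cases i <;> simp [modelNormal]
    ring
  rw [e]
  exact (hq.const_smul (-κ)).const_add _

theorem hasDerivWithinAt_productMetric {Y Z : ℝ → AmbientSpace} {Y' Z' : AmbientSpace}
    (hY : HasDerivWithinAt Y Y' s t) (hZ : HasDerivWithinAt Z Z' s t) :
    HasDerivWithinAt (fun r => modelForm κ (Y r).1 (Z r).1 + (Y r).2 * (Z r).2)
      ((modelForm κ Y'.1 (Z t).1 + Y'.2 * (Z t).2)
        + (modelForm κ (Y t).1 Z'.1 + (Y t).2 * Z'.2)) s t := by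
  refine ((hasDerivWithinAt_modelForm hY.fst hZ.fst).add
    ((hasDerivWithinAt_snd hY).mul (hasDerivWithinAt_snd hZ))).congr_deriv ?_
  ring

end ProductRules

/-! ### Curves whose conormal in a surface is parallel -/

/-- A unit-speed curve `γ` in `𝕄²(κ) × ℝ` with a unit normal field `N`, both smooth, such that `∂_z`
lies in the plane spanned by `γ'` and `N`, and such that `γ''` and `N'` are orthogonal to the
conormal `N × γ'`, which is therefore parallel along `γ`. The normal of a surface
along a geodesic line of curvature to which the tangential part of `∂_z` is tangent is of this
kind. -/
structure IsAdaptedCurve (κ ℓ : ℝ) (γ N : ℝ → AmbientSpace) : Prop where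
  smooth : ContDiffOn ℝ ∞ γ (Icc 0 ℓ)
  normal_smooth : ContDiffOn ℝ ∞ N (Icc 0 ℓ)
  mem : ∀ t ∈ Icc 0 ℓ, γ t ∈ (productSpace κ).carrier
  velocity_mem : ∀ t ∈ Icc 0 ℓ, derivWithin γ (Icc 0 ℓ) t ∈ (productSpace κ).tangent (γ t)
  normal_mem : ∀ t ∈ Icc 0 ℓ, N t ∈ (productSpace κ).tangent (γ t)
  velocity_unit : ∀ t ∈ Icc 0 ℓ, (productSpace κ).metric (γ t)
    (derivWithin γ (Icc 0 ℓ) t) (derivWithin γ (Icc 0 ℓ) t) = 1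
  normal_unit : ∀ t ∈ Icc 0 ℓ, (productSpace κ).metric (γ t) (N t) (N t) = 1
  orthogonal : ∀ t ∈ Icc 0 ℓ, (productSpace κ).metric (γ t) (N t) (derivWithin γ (Icc 0 ℓ) t) = 0
  vertical : ∀ t ∈ Icc 0 ℓ, ((0, 1) : AmbientSpace) =
    (derivWithin γ (Icc 0 ℓ) t).2 • derivWithin γ (Icc 0 ℓ) t + (N t).2 • N t
  accel_conormal : ∀ t ∈ Icc 0 ℓ, (productSpace κ).metric (γ t)
    (derivWithin (derivWithin γ (Icc 0 ℓ)) (Icc 0 ℓ) t)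
    (productCross κ (γ t) (N t) (derivWithin γ (Icc 0 ℓ) t)) = 0
  deriv_normal_conormal : ∀ t ∈ Icc 0 ℓ, (productSpace κ).metric (γ t)
    (derivWithin N (Icc 0 ℓ) t) (productCross κ (γ t) (N t) (derivWithin γ (Icc 0 ℓ) t)) = 0

namespace IsAdaptedCurve

variable {κ ℓ : ℝ} {γ N : ℝ → AmbientSpace}

theorem hasDerivWithinAt (h : IsAdaptedCurve κ ℓ γ N) {t : ℝ} (ht : t ∈ Icc 0 ℓ) :
    HasDerivWithinAt γ (derivWithin γ (Icc 0 ℓ) t) (Icc 0 ℓ) t :=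
  (h.smooth.differentiableOn (by simp) t ht).hasDerivWithinAt

theorem hasDerivWithinAt_normal (h : IsAdaptedCurve κ ℓ γ N) {t : ℝ} (ht : t ∈ Icc 0 ℓ) :
    HasDerivWithinAt N (derivWithin N (Icc 0 ℓ) t) (Icc 0 ℓ) t :=
  (h.normal_smooth.differentiableOn (by simp) t ht).hasDerivWithinAt

theorem contDiffOn_velocity (h : IsAdaptedCurve κ ℓ γ N) (hℓ : 0 < ℓ) :
    ContDiffOn ℝ ∞ (derivWithin γ (Icc 0 ℓ)) (Icc 0 ℓ) :=
  h.smooth.derivWithin (uniqueDiffOn_Icc hℓ) (by simp)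

theorem hasDerivWithinAt_velocity (h : IsAdaptedCurve κ ℓ γ N) (hℓ : 0 < ℓ) {t : ℝ}
    (ht : t ∈ Icc 0 ℓ) : HasDerivWithinAt (derivWithin γ (Icc 0 ℓ))
      (derivWithin (derivWithin γ (Icc 0 ℓ)) (Icc 0 ℓ) t) (Icc 0 ℓ) t :=
  ((h.contDiffOn_velocity hℓ).differentiableOn (by simp) t ht).hasDerivWithinAt

theorem sq_add_sq (h : IsAdaptedCurve κ ℓ γ N) {t : ℝ} (ht : t ∈ Icc 0 ℓ) :
    (derivWithin γ (Icc 0 ℓ) t).2 ^ 2 + (N t).2 ^ 2 = 1 := by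
  have := congrArg Prod.snd (h.vertical t ht)
  simp at this
  linarith

/-- Both `γ'` and `N` project to multiples of one horizontal vector. -/
theorem horizontal_part (h : IsAdaptedCurve κ ℓ γ N) {t : ℝ} (ht : t ∈ Icc 0 ℓ) :
    (derivWithin γ (Icc 0 ℓ) t).1 = (N t).2 •
      ((N t).2 • (derivWithin γ (Icc 0 ℓ) t).1 - (derivWithin γ (Icc 0 ℓ) t).2 • (N t).1) ∧
    (N t).1 = -(derivWithin γ (Icc 0 ℓ) t).2 •
      ((N t).2 • (derivWithin γ (Icc 0 ℓ) t).1 - (derivWithin γ (Icc 0 ℓ) t).2 • (N t).1) := by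
  have h1 := h.sq_add_sq ht
  have h2 := congrArg Prod.fst (h.vertical t ht)
  constructor
  all_goals
    ext i
    have h3 := congrFun h2 i
    simp only [Prod.fst_add, Prod.smul_fst, Pi.add_apply, Pi.sub_apply, Pi.smul_apply,
      smul_eq_mul, Pi.zero_apply] at h3 ⊢
  · linear_combination -(derivWithin γ (Icc 0 ℓ) t).1 i * h1
      - (derivWithin γ (Icc 0 ℓ) t).2 * h3
  · linear_combination -(N t).1 i * h1 - (N t).2 * h3

theorem conormal_velocity (t : ℝ) : (productSpace κ).metric (γ t)
    (productCross κ (γ t) (N t) (derivWithin γ (Icc 0 ℓ) t)) (derivWithin γ (Icc 0 ℓ) t) = 0 := by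
  rw [metric_productCross, (OrientedModel.isRegular_productSpace κ).vol_self]

theorem conormal_normal (t : ℝ) : (productSpace κ).metric (γ t)
    (productCross κ (γ t) (N t) (derivWithin γ (Icc 0 ℓ) t)) (N t) = 0 := by
  simp only [metric_productSpace, productCross, modelForm_sub_left, modelForm_smul_left,
    modelForm_modelRotation, areaForm]
  ring

theorem conormal_unit (h : IsAdaptedCurve κ ℓ γ N) {t : ℝ} (ht : t ∈ Icc 0 ℓ) :
    (productSpace κ).metric (γ t)
      (productCross κ (γ t) (N t) (derivWithin γ (Icc 0 ℓ) t))
      (productCross κ (γ t) (N t) (derivWithin γ (Icc 0 ℓ) t)) = 1 := by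
  rw [metric_productCross_self (h.mem t ht) (h.normal_mem t ht) (h.velocity_mem t ht),
    h.normal_unit t ht, h.velocity_unit t ht, h.orthogonal t ht]
  norm_num

theorem conormal_snd (h : IsAdaptedCurve κ ℓ γ N) {t : ℝ} (ht : t ∈ Icc 0 ℓ) :
    (productCross κ (γ t) (N t) (derivWithin γ (Icc 0 ℓ) t)).2 = 0 := by
  have hm := (OrientedModel.isRegular_productSpace κ).metric
  have h1 : (productSpace κ).metric (γ t)
      (productCross κ (γ t) (N t) (derivWithin γ (Icc 0 ℓ) t)) (0, 1) = 0 := by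
    rw [h.vertical t ht, hm.add_right, hm.smul_right, hm.smul_right, conormal_velocity,
      conormal_normal]
    ring
  simpa [metric_productSpace, modelForm] using h1

theorem differentiableWithinAt_conormal (h : IsAdaptedCurve κ ℓ γ N) (hℓ : 0 < ℓ) {t : ℝ}
    (ht : t ∈ Icc 0 ℓ) : DifferentiableWithinAt ℝ
      (fun r => productCross κ (γ r) (N r) (derivWithin γ (Icc 0 ℓ) r)) (Icc 0 ℓ) t := by
  have h1 := (h.hasDerivWithinAt ht).differentiableWithinAt
  have h2 := (h.hasDerivWithinAt_normal ht).differentiableWithinAt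
  have h3 := (h.hasDerivWithinAt_velocity hℓ ht).differentiableWithinAt
  have hN := differentiableWithinAt_modelRotation (κ := κ) h1.fst h2.fst
  have hv := differentiableWithinAt_modelRotation (κ := κ) h1.fst h3.fst
  refine DifferentiableWithinAt.prodMk ((h2.snd.smul hv).sub (h3.snd.smul hN)) ?_
  have e : (fun r => areaForm κ (γ r).1 (N r).1 (derivWithin γ (Icc 0 ℓ) r).1) =
      fun r => modelForm κ (modelRotation κ (γ r).1 (N r).1) (derivWithin γ (Icc 0 ℓ) r).1 :=
    funext fun r => modelForm_modelRotation.symm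
  rw [e]
  exact (hasDerivWithinAt_modelForm hN.hasDerivWithinAt
    h3.fst.hasDerivWithinAt).differentiableWithinAt

/-- The conormal and the vector `b`, of which `γ'` and `N` project to multiples, are horizontal and
form an orthonormal frame of `𝕄²(κ)`. -/
theorem horizontal_frame (h : IsAdaptedCurve κ ℓ γ N) {t : ℝ} (ht : t ∈ Icc 0 ℓ) {b : Fin 3 → ℝ}
    (hb : b = (N t).2 • (derivWithin γ (Icc 0 ℓ) t).1 - (derivWithin γ (Icc 0 ℓ) t).2 • (N t).1) :
    conormalForm κ (γ t).1 b = 0 ∧ modelForm κ b b = 1 ∧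
      modelForm κ (productCross κ (γ t) (N t) (derivWithin γ (Icc 0 ℓ) t)).1 b = 0 ∧
      conormalForm κ (γ t).1 (productCross κ (γ t) (N t) (derivWithin γ (Icc 0 ℓ) t)).1 = 0 ∧
      modelForm κ (productCross κ (γ t) (N t) (derivWithin γ (Icc 0 ℓ) t)).1
        (productCross κ (γ t) (N t) (derivWithin γ (Icc 0 ℓ) t)).1 = 1 := by
  have hpart := h.horizontal_part ht
  rw [← hb] at hpart
  have hsq := h.sq_add_sq ht
  have hv := h.velocity_mem t ht
  have hN := h.normal_mem t ht
  have hvv := h.velocity_unit t ht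
  have hNN := h.normal_unit t ht
  have hηη := h.conormal_unit ht
  have hηv := conormal_velocity (κ := κ) (ℓ := ℓ) (γ := γ) (N := N) t
  have hηN := conormal_normal (κ := κ) (ℓ := ℓ) (γ := γ) (N := N) t
  have hη : conormalForm κ _ _ = 0 := productCross_mem_tangent (κ := κ) (p := γ t) (u := N t)
    (v := derivWithin γ (Icc 0 ℓ) t)
  rw [mem_tangent_productSpace] at hv hN
  simp only [metric_productSpace, h.conormal_snd ht, zero_mul, add_zero] at hηη hηv hηN hvv hNN
  refine ⟨?_, ?_, ?_, hη, hηη⟩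
  · rw [hb, conormalForm_sub, conormalForm_smul, conormalForm_smul, hv, hN]; ring
  · rw [hpart.1, modelForm_smul_left, modelForm_smul_right] at hvv
    rw [hpart.2, modelForm_smul_left, modelForm_smul_right] at hNN
    linear_combination hvv + hNN - (1 + modelForm κ b b) * hsq
  · rw [hb, modelForm_sub_right, modelForm_smul_right, modelForm_smul_right, hηv, hηN]; ring

/-- The conormal `N × γ'` is constant as a vector of `ℝ³ × ℝ`: it is parallel along `γ`, and the
second fundamental form of the quadric vanishes on the pair consisting of it and `γ'`. -/
theorem conormal_eq_initial (h : IsAdaptedCurve κ ℓ γ N) (hℓ : 0 < ℓ) {t : ℝ} (ht : t ∈ Icc 0 ℓ) :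
    productCross κ (γ t) (N t) (derivWithin γ (Icc 0 ℓ) t) =
      productCross κ (γ 0) (N 0) (derivWithin γ (Icc 0 ℓ) 0) := by
  refine eq_initial_of_hasDerivWithinAt_zero
    (f := fun r => productCross κ (γ r) (N r) (derivWithin γ (Icc 0 ℓ) r)) (fun t ht => ?_) hℓ ht
  have hη := (h.differentiableWithinAt_conormal hℓ ht).hasDerivWithinAt
  set η := fun r => productCross κ (γ r) (N r) (derivWithin γ (Icc 0 ℓ) r)
  set δ := derivWithin η (Icc 0 ℓ) t
  have hγ := h.hasDerivWithinAt ht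
  have hN := h.hasDerivWithinAt_normal ht
  have hv := h.hasDerivWithinAt_velocity hℓ ht
  obtain ⟨hb, hbb, hηb, hηT, hηη⟩ := h.horizontal_frame ht rfl
  have hη2 : (η t).2 = 0 := h.conormal_snd ht
  have hδ2 : δ.2 = 0 := deriv_eq_zero_of_const_on hℓ ht hη.snd fun x hx => h.conormal_snd hx
  have hδη := deriv_eq_zero_of_const_on hℓ ht
    (hasDerivWithinAt_productMetric (κ := κ) hη hη) fun x hx => h.conormal_unit hx
  have hδv := deriv_eq_zero_of_const_on hℓ ht
    (hasDerivWithinAt_productMetric (κ := κ) hη hv) fun x _ => conormal_velocity x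
  have hδN := deriv_eq_zero_of_const_on hℓ ht
    (hasDerivWithinAt_productMetric (κ := κ) hη hN) fun x _ => conormal_normal x
  have hδT := deriv_eq_zero_of_const_on hℓ ht
    (hasDerivWithinAt_conormalForm (κ := κ) hγ.fst hη.fst) fun x _ => productCross_mem_tangent
  have hacc := h.accel_conormal t ht
  have hNη := h.deriv_normal_conormal t ht
  have hvη := conormal_velocity (κ := κ) (ℓ := ℓ) (γ := γ) (N := N) t
  change (productSpace κ).metric (γ t) _ (η t) = 0 at hacc
  change (productSpace κ).metric (γ t) _ (η t) = 0 at hNη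
  change (productSpace κ).metric (γ t) (η t) _ = 0 at hvη
  change modelForm κ (η t).1 (η t).1 = 1 at hηη
  simp only [metric_productSpace, hη2, hδ2, mul_zero, zero_mul, add_zero]
    at hδη hδv hδN hacc hNη hvη
  rw [modelForm_comm] at hacc hNη
  rw [hacc, add_zero] at hδv
  rw [hNη, add_zero] at hδN
  rw [modelForm_comm (u := (η t).1)] at hδη hvη
  have hδη' : modelForm κ δ.1 (η t).1 = 0 := by linarith
  have hδT' : conormalForm κ (γ t).1 δ.1 = 0 := by
    change modelForm κ _ (η t).1 + _ = 0 at hδT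
    linarith
  have h0 : δ.1 = 0 := by
    refine eq_zero_of_orthogonal_frame (h.mem t ht) hηT hb hδT' hηη hbb hηb hδη' ?_
    rw [modelForm_sub_right, modelForm_smul_right, modelForm_smul_right, hδv, hδN]
    ring
  exact hη.congr_deriv (Prod.ext h0 hδ2)

/-- An adapted curve lies in the vertical plane over a geodesic with normal `N × γ'`. -/
theorem exists_geodesicWithNormal (h : IsAdaptedCurve κ ℓ γ N) (hℓ : 0 < ℓ) :
    ∃ (c : ℝ → Fin 3 → ℝ) (a : Fin 3 → ℝ), GeodesicWithNormal κ c a ∧ ∀ t ∈ Icc 0 ℓ,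
      productCross κ (γ t) (N t) (derivWithin γ (Icc 0 ℓ) t) = (a, 0) ∧ ∃ s, (γ t).1 = c s := by
  have h0 : (0 : ℝ) ∈ Icc 0 ℓ := ⟨le_rfl, hℓ.le⟩
  set b : ℝ → Fin 3 → ℝ := fun t =>
    (N t).2 • (derivWithin γ (Icc 0 ℓ) t).1 - (derivWithin γ (Icc 0 ℓ) t).2 • (N t).1
  set a := (productCross κ (γ 0) (N 0) (derivWithin γ (Icc 0 ℓ) 0)).1
  have hη : ∀ t ∈ Icc 0 ℓ,
      productCross κ (γ t) (N t) (derivWithin γ (Icc 0 ℓ) t) = (a, 0) := fun t ht =>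
    (h.conormal_eq_initial hℓ ht).trans (Prod.ext rfl (h.conormal_snd h0))
  have hframe : ∀ t ∈ Icc 0 ℓ, conormalForm κ (γ t).1 (b t) = 0 ∧ modelForm κ (b t) (b t) = 1 ∧
      modelForm κ a (b t) = 0 ∧ conormalForm κ (γ t).1 a = 0 ∧ modelForm κ a a = 1 := by
    intro t ht
    have := h.horizontal_frame ht (b := b t) rfl
    rwa [hη t ht] at this
  have hβ : ∀ t ∈ Icc 0 ℓ, HasDerivWithinAt (fun r => (γ r).1) ((N t).2 • b t) (Icc 0 ℓ) t :=
    fun t ht => (hasDerivWithinAt_fst (h.hasDerivWithinAt ht)).congr_deriv (h.horizontal_part ht).1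
  -- the equation of the Frenet frame of a geodesic, with the speed `N.2`
  have hb : ∀ t ∈ Icc 0 ℓ,
      HasDerivWithinAt b ((N t).2 • modelNormal κ (γ t).1) (Icc 0 ℓ) t := by
    intro t ht
    obtain ⟨hbT, hbb, hab, haT, haa⟩ := hframe t ht
    have hN := h.hasDerivWithinAt_normal ht
    have hv := h.hasDerivWithinAt_velocity hℓ ht
    have hd : HasDerivWithinAt b _ (Icc 0 ℓ) t :=
      ((hasDerivWithinAt_snd hN).smul (hasDerivWithinAt_fst hv)).sub
      ((hasDerivWithinAt_snd hv).smul (hasDerivWithinAt_fst hN))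
    refine hd.congr_deriv (sub_eq_zero.1 ?_)
    have e1 := deriv_eq_zero_of_const_on hℓ ht
      (hasDerivWithinAt_conormalForm (κ := κ) (hβ t ht) hd) fun x hx => (hframe x hx).1
    have e2 := deriv_eq_zero_of_const_on hℓ ht
      (hasDerivWithinAt_modelForm (κ := κ) hd hd) fun x hx => (hframe x hx).2.1
    have e3 := deriv_eq_zero_of_const_on hℓ ht (hasDerivWithinAt_modelForm (κ := κ)
      (hasDerivWithinAt_const t (Icc 0 ℓ) a) hd) fun x hx => (hframe x hx).2.2.1
    rw [modelForm_smul_left, hbb] at e1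
    rw [modelForm_comm (u := b t)] at e2
    rw [show modelForm κ 0 (b t) = 0 by simp [modelForm], zero_add, modelForm_comm (u := a)] at e3
    refine eq_zero_of_orthogonal_frame (h.mem t ht) haT hbT ?_ haa hbb hab ?_ ?_
    · rw [conormalForm_sub, conormalForm_smul, conormalForm_modelNormal (h.mem t ht)]
      linarith
    · rw [modelForm_sub_left, modelForm_smul_left, modelForm_modelNormal, haT]
      linarith
    · rw [modelForm_sub_left, modelForm_smul_left, modelForm_modelNormal, hbT]
      linarith
  obtain ⟨S, C, hSc, hCc, hS, hC, hS0, hC0, hSC⟩ := exists_generalized_sine κ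
  obtain ⟨hb0T, hb0b, hab0, ha0T, haa⟩ := hframe 0 h0
  have hc := geodesicWithNormal (h.mem 0 h0) ha0T hb0T haa hb0b hab0 hSc hCc hS hC hS0 hC0 hSC
  refine ⟨_, a, hc, fun t ht => ⟨hη t ht, ?_⟩⟩
  obtain ⟨σ, hσ0, -, hσ⟩ := exists_contDiffOn_primitive hℓ h.normal_smooth.snd
  have hSσ : ∀ t ∈ Icc 0 ℓ, HasDerivWithinAt (fun r => S (σ r))
      ((1 - κ * C (σ t)) * (N t).2) (Icc 0 ℓ) t := fun t ht =>
    (hS (σ t)).comp_hasDerivWithinAt t (hσ t ht)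
  have hCσ : ∀ t ∈ Icc 0 ℓ, HasDerivWithinAt (fun r => C (σ r))
      (S (σ t) * (N t).2) (Icc 0 ℓ) t := fun t ht =>
    (hC (σ t)).comp_hasDerivWithinAt t (hσ t ht)
  have hn : ∀ t ∈ Icc 0 ℓ, HasDerivWithinAt (fun r => modelNormal κ (γ r).1)
      (-κ • ((N t).2 • b t)) (Icc 0 ℓ) t := fun t ht => hasDerivWithinAt_modelNormal (hβ t ht)
  -- rotating the frame back by the angle `σ` gives the initial frame
  have k1 : ∀ t ∈ Icc 0 ℓ,
      (1 - κ * C (σ t)) • b t - S (σ t) • modelNormal κ (γ t).1 = b 0 := by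
    intro t ht
    have := eq_initial_of_hasDerivWithinAt_zero (f := fun t =>
      (1 - κ * C (σ t)) • b t - S (σ t) • modelNormal κ (γ t).1) (fun x hx => by
        refine (((((hCσ x hx).const_mul κ).const_sub 1).smul (hb x hx)).sub
          ((hSσ x hx).smul (hn x hx))).congr_deriv ?_
        module) hℓ ht
    rw [this]
    simp [hσ0, hS0, hC0]
  have k2 : ∀ t ∈ Icc 0 ℓ,
      (1 - κ * C (σ t)) • modelNormal κ (γ t).1 + (κ * S (σ t)) • b t = modelNormal κ (γ 0).1 := by
    intro t ht
    have := eq_initial_of_hasDerivWithinAt_zero (f := fun t =>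
      (1 - κ * C (σ t)) • modelNormal κ (γ t).1 + (κ * S (σ t)) • b t) (fun x hx => by
        refine (((((hCσ x hx).const_mul κ).const_sub 1).smul (hn x hx)).add
          (((hSσ x hx).const_mul κ).smul (hb x hx))).congr_deriv ?_
        module) hℓ ht
    rw [this]
    simp [hσ0, hS0, hC0]
  have k3 : ∀ t ∈ Icc 0 ℓ,
      (1 - κ * C (σ t)) • b 0 + S (σ t) • modelNormal κ (γ 0).1 = b t := by
    intro t ht
    rw [← k1 t ht, ← k2 t ht]
    have e : (1 - κ * C (σ t)) ^ 2 + κ * S (σ t) ^ 2 = 1 := by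
      linear_combination κ * hSC (σ t)
    calc _ = ((1 - κ * C (σ t)) ^ 2 + κ * S (σ t) ^ 2) • b t := by module
      _ = b t := by rw [e, one_smul]
  refine ⟨σ t, sub_eq_zero.1 ?_⟩
  have := eq_initial_of_hasDerivWithinAt_zero (f := fun t => (γ t).1 - ((γ 0).1 + S (σ t) • b 0
    + C (σ t) • modelNormal κ (γ 0).1)) (fun x hx => by
      refine ((hβ x hx).sub ((((hSσ x hx).smul_const (b 0)).const_add _).add
        ((hCσ x hx).smul_const _))).congr_deriv ?_
      rw [← k3 x hx]
      module) hℓ ht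
  rw [this]
  simp [hσ0, hS0, hC0]

/-- Expand `∂_z` in terms of `γ'` and `N`, and use that `γ''` is orthogonal to `γ'`. -/
theorem accel_snd (h : IsAdaptedCurve κ ℓ γ N) (hℓ : 0 < ℓ) {t : ℝ} (ht : t ∈ Icc 0 ℓ) :
    (derivWithin (derivWithin γ (Icc 0 ℓ)) (Icc 0 ℓ) t).2 = (N t).2 *
      (productSpace κ).metric (γ t) (derivWithin (derivWithin γ (Icc 0 ℓ)) (Icc 0 ℓ) t) (N t) := by
  have hm := (OrientedModel.isRegular_productSpace κ).metric
  have hv := h.hasDerivWithinAt_velocity hℓ ht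
  have e1 := deriv_eq_zero_of_const_on hℓ ht
    (hasDerivWithinAt_productMetric (κ := κ) hv hv) fun x hx => h.velocity_unit x hx
  set w := derivWithin (derivWithin γ (Icc 0 ℓ)) (Icc 0 ℓ) t
  change (productSpace κ).metric (γ t) _ _ + (productSpace κ).metric (γ t) _ _ = 0 at e1
  rw [hm.symm _ _ w] at e1
  have e2 : (productSpace κ).metric (γ t) w (0, 1) = w.2 := by
    simp [metric_productSpace, modelForm]
  rw [← e2, h.vertical t ht, hm.add_right, hm.smul_right, hm.smul_right]
  linear_combination (derivWithin γ (Icc 0 ℓ) t).2 / 2 * e1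

theorem deriv_normal_snd (h : IsAdaptedCurve κ ℓ γ N) (hℓ : 0 < ℓ) {t : ℝ} (ht : t ∈ Icc 0 ℓ) :
    (derivWithin N (Icc 0 ℓ) t).2 = -(derivWithin γ (Icc 0 ℓ) t).2 *
      (productSpace κ).metric (γ t) (derivWithin (derivWithin γ (Icc 0 ℓ)) (Icc 0 ℓ) t) (N t) := by
  have hm := (OrientedModel.isRegular_productSpace κ).metric
  have hv := h.hasDerivWithinAt_velocity hℓ ht
  have hN := h.hasDerivWithinAt_normal ht
  have e1 := deriv_eq_zero_of_const_on hℓ ht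
    (hasDerivWithinAt_productMetric (κ := κ) hN hN) fun x hx => h.normal_unit x hx
  have e3 := deriv_eq_zero_of_const_on hℓ ht
    (hasDerivWithinAt_productMetric (κ := κ) hN hv) fun x hx => h.orthogonal x hx
  set w := derivWithin N (Icc 0 ℓ) t
  change (productSpace κ).metric (γ t) _ _ + (productSpace κ).metric (γ t) _ _ = 0 at e1
  change (productSpace κ).metric (γ t) _ _ + (productSpace κ).metric (γ t) _ _ = 0 at e3
  rw [hm.symm _ _ w] at e1
  rw [hm.symm _ (N t)] at e3
  have e2 : (productSpace κ).metric (γ t) w (0, 1) = w.2 := by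
    simp [metric_productSpace, modelForm]
  rw [← e2, h.vertical t ht, hm.add_right, hm.smul_right, hm.smul_right]
  linear_combination (derivWithin γ (Icc 0 ℓ) t).2 * e3 + (N t).2 / 2 * e1

theorem contDiffOn_curvature (h : IsAdaptedCurve κ ℓ γ N) (hℓ : 0 < ℓ) :
    ContDiffOn ℝ ∞ (fun t => (productSpace κ).metric (γ t)
      (derivWithin (derivWithin γ (Icc 0 ℓ)) (Icc 0 ℓ) t) (N t)) (Icc 0 ℓ) := by
  have hw : ContDiffOn ℝ ∞ (derivWithin (derivWithin γ (Icc 0 ℓ)) (Icc 0 ℓ)) (Icc 0 ℓ) :=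
    (h.contDiffOn_velocity hℓ).derivWithin (uniqueDiffOn_Icc hℓ) (by simp)
  have h1 := contDiffOn_pi.1 hw.fst
  have h2 := contDiffOn_pi.1 h.normal_smooth.fst
  exact ((((h1 0).mul (h2 0)).add ((h1 1).mul (h2 1))).add
    (contDiffOn_const.mul ((h1 2).mul (h2 2)))).add (hw.snd.mul h.normal_smooth.snd)

/-- With `hasDerivWithinAt_sin`: the vector `(-z', N.2)`, which is `(cos θ, sin θ)` for the angle of
rotation `θ`, turns with angular velocity the geodesic curvature `⟨γ'', N⟩`. -/
theorem hasDerivWithinAt_cos (h : IsAdaptedCurve κ ℓ γ N) (hℓ : 0 < ℓ) {t : ℝ}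
    (ht : t ∈ Icc 0 ℓ) : HasDerivWithinAt (fun r => -(derivWithin γ (Icc 0 ℓ) r).2)
      (-((N t).2 * (productSpace κ).metric (γ t)
        (derivWithin (derivWithin γ (Icc 0 ℓ)) (Icc 0 ℓ) t) (N t))) (Icc 0 ℓ) t := by
  rw [← h.accel_snd hℓ ht]
  exact (hasDerivWithinAt_snd (h.hasDerivWithinAt_velocity hℓ ht)).neg

theorem hasDerivWithinAt_sin (h : IsAdaptedCurve κ ℓ γ N) (hℓ : 0 < ℓ) {t : ℝ}
    (ht : t ∈ Icc 0 ℓ) : HasDerivWithinAt (fun r => (N r).2)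
      (-(derivWithin γ (Icc 0 ℓ) t).2 * (productSpace κ).metric (γ t)
        (derivWithin (derivWithin γ (Icc 0 ℓ)) (Icc 0 ℓ) t) (N t)) (Icc 0 ℓ) t := by
  rw [← h.deriv_normal_snd hℓ ht]
  exact hasDerivWithinAt_snd (h.hasDerivWithinAt_normal ht)

end IsAdaptedCurve

/-! ### Rotations of a Euclidean plane -/

section Rotation

variable {E : Type*} [NormedAddCommGroup E] [InnerProductSpace ℝ E] {J : E →ₗ[ℝ] E}

theorem inner_rotation_left (h0 : ∀ u, ⟪J u, u⟫_ℝ = 0) (u v : E) : ⟪J u, v⟫_ℝ = -⟪u, J v⟫_ℝ := by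
  have h := h0 (u + v)
  rw [map_add, inner_add_left, inner_add_right, inner_add_right, h0, h0,
    real_inner_comm u (J v)] at h
  linarith

theorem rotation_rotation (h1 : ∀ u, ⟪J u, J u⟫_ℝ = ⟪u, u⟫_ℝ) (h0 : ∀ u, ⟪J u, u⟫_ℝ = 0) (u : E) :
    J (J u) = -u := by
  have h : ⟪J (J u) + u, J (J u) + u⟫_ℝ = 0 := by
    rw [inner_add_left, inner_add_right, inner_add_right, h1, h1, real_inner_comm (J (J u)) u,
      inner_rotation_left h0 (J u) u, h1]
    ring
  exact eq_neg_of_add_eq_zero_left (inner_self_eq_zero.1 h)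

theorem inner_rotation_rotation (h1 : ∀ u, ⟪J u, J u⟫_ℝ = ⟪u, u⟫_ℝ) (h0 : ∀ u, ⟪J u, u⟫_ℝ = 0)
    (u v : E) : ⟪J u, J v⟫_ℝ = ⟪u, v⟫_ℝ := by
  rw [inner_rotation_left h0, rotation_rotation h1 h0, inner_neg_right, neg_neg]

theorem eq_smul_rotation_of_inner_eq_zero (hdim : Module.finrank ℝ E = 2)
    (h1 : ∀ u, ⟪J u, J u⟫_ℝ = ⟪u, u⟫_ℝ) (h0 : ∀ u, ⟪J u, u⟫_ℝ = 0) {e v : E} (he : ‖e‖ = 1)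
    (hv : ⟪v, e⟫_ℝ = 0) : v = ⟪v, J e⟫_ℝ • J e := by
  have hJe : ‖J e‖ = 1 := by
    have : ‖J e‖ ^ 2 = 1 := by
      rw [← real_inner_self_eq_norm_sq, h1, real_inner_self_eq_norm_sq, he, one_pow]
    nlinarith [norm_nonneg (J e)]
  have hon : Orthonormal ℝ ![e, J e] := by
    rw [orthonormal_iff_ite]
    intro i j
    have e1 : ⟪e, J e⟫_ℝ = 0 := by rw [real_inner_comm, h0]
    fin_cases i <;> fin_cases j <;> simp [he, hJe, h0, e1]
  have : FiniteDimensional ℝ E := .of_finrank_pos (by rw [hdim]; norm_num)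
  have hspan : ⊤ ≤ Submodule.span ℝ (range ![e, J e]) := by
    have := hon.linearIndependent.span_eq_top_of_card_eq_finrank (by simp [hdim])
    rw [this]
  have hsum := (OrthonormalBasis.mk hon hspan).sum_repr' v
  simp only [OrthonormalBasis.coe_mk, Fin.sum_univ_two, Matrix.cons_val_zero,
    Matrix.cons_val_one] at hsum
  rw [real_inner_comm, hv, zero_smul, zero_add, real_inner_comm] at hsum
  exact hsum.symm

end Rotation

theorem exists_cos_sin_eq {x y : ℝ} (h : x ^ 2 + y ^ 2 = 1) :
    ∃ θ : ℝ, x = Real.cos θ ∧ y = Real.sin θ := by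
  have hn : ‖(⟨x, y⟩ : ℂ)‖ = 1 := by
    rw [Complex.norm_eq_sqrt_sq_add_sq, h, Real.sqrt_one]
  have hne : (⟨x, y⟩ : ℂ) ≠ 0 := by
    rw [← norm_ne_zero_iff, hn]; norm_num
  refine ⟨Complex.arg ⟨x, y⟩, ?_, ?_⟩
  · rw [Complex.cos_arg hne, hn, div_one]
  · rw [Complex.sin_arg, hn, div_one]

/-- A unit vector that rotates with smooth angular velocity `k` has a smooth angle. -/
theorem exists_smooth_angle {ℓ : ℝ} (hℓ : 0 < ℓ) {μ ν k : ℝ → ℝ} (hk : ContDiffOn ℝ ∞ k (Icc 0 ℓ))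
    (hμ : ∀ t ∈ Icc 0 ℓ, HasDerivWithinAt μ (-(ν t * k t)) (Icc 0 ℓ) t)
    (hν : ∀ t ∈ Icc 0 ℓ, HasDerivWithinAt ν (μ t * k t) (Icc 0 ℓ) t)
    (h : μ 0 ^ 2 + ν 0 ^ 2 = 1) : ∃ θ : ℝ → ℝ, ContDiffOn ℝ ∞ θ (Icc 0 ℓ) ∧
      ∀ t ∈ Icc 0 ℓ, μ t = Real.cos (θ t) ∧ ν t = Real.sin (θ t) := by
  obtain ⟨F, hF0, hFs, hF⟩ := exists_contDiffOn_primitive hℓ hk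
  obtain ⟨θ₀, hθc, hθs⟩ := exists_cos_sin_eq h
  have hθ : ∀ t ∈ Icc 0 ℓ, HasDerivWithinAt (fun r => θ₀ + F r) (k t) (Icc 0 ℓ) t := fun t ht =>
    (hF t ht).const_add _
  refine ⟨fun t => θ₀ + F t, contDiffOn_const.add hFs, fun t ht => ?_⟩
  have e1 : μ t * Real.cos (θ₀ + F t) + ν t * Real.sin (θ₀ + F t)
      = μ 0 * Real.cos (θ₀ + F 0) + ν 0 * Real.sin (θ₀ + F 0) :=
    eq_initial_of_hasDerivWithinAt_zero
      (f := fun t => μ t * Real.cos (θ₀ + F t) + ν t * Real.sin (θ₀ + F t)) (fun x hx => by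
        refine (((hμ x hx).mul (hθ x hx).cos).add ((hν x hx).mul (hθ x hx).sin)).congr_deriv ?_
        ring) hℓ ht
  have e2 : μ t * Real.sin (θ₀ + F t) - ν t * Real.cos (θ₀ + F t)
      = μ 0 * Real.sin (θ₀ + F 0) - ν 0 * Real.cos (θ₀ + F 0) :=
    eq_initial_of_hasDerivWithinAt_zero
      (f := fun t => μ t * Real.sin (θ₀ + F t) - ν t * Real.cos (θ₀ + F t)) (fun x hx => by
        refine (((hμ x hx).mul (hθ x hx).sin).sub ((hν x hx).mul (hθ x hx).cos)).congr_deriv ?_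
        ring) hℓ ht
  rw [hF0, add_zero, ← hθc, ← hθs] at e1 e2
  have e3 := Real.sin_sq_add_cos_sq (θ₀ + F t)
  constructor
  · linear_combination Real.cos (θ₀ + F t) * e1 + Real.sin (θ₀ + F t) * e2 - μ t * e3
      + Real.cos (θ₀ + F t) * h
  · linear_combination Real.sin (θ₀ + F t) * e1 - Real.cos (θ₀ + F t) * e2 - ν t * e3
      + Real.sin (θ₀ + F t) * h

/-! ### Conjugate immersions along a horizontal geodesic -/

section Conjugate

variable {HS S : Type*} [TopologicalSpace HS] [TopologicalSpace S]
  {I : ModelWithCorners ℝ (EuclideanSpace ℝ (Fin 2)) HS} [ChartedSpace HS S]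
  [RiemannianBundle (fun p : S => TangentSpace I p)]

namespace HasFundamentalData

variable {κ : ℝ} {φ N : S → AmbientSpace} {D : SurfaceData I (S := S)}

theorem surfaceDiff_rotation (h : HasFundamentalData (productSpace κ) φ N D) (p : S)
    (u : TangentSpace I p) : surfaceDiff I φ p (D.J p u) =
      productCross κ (φ p) (N p) (surfaceDiff I φ p u) := by
  have hE := OrientedModel.isRegular_productSpace κ
  refine eq_of_metric_eq (h.mem p) (hE.surfaceDiff_mem_tangent h.smooth h.mem p _)
    productCross_mem_tangent fun w hw => ?_
  rw [metric_productCross, h.rotation p u w hw]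

theorem inner_rotation (h : HasFundamentalData (productSpace κ) φ N D) (p : S)
    (u : TangentSpace I p) : ⟪D.J p u, D.J p u⟫_ℝ = ⟪u, u⟫_ℝ := by
  have hE := OrientedModel.isRegular_productSpace κ
  rw [← h.isometric, h.surfaceDiff_rotation, metric_productCross_self (h.mem p) (h.normal_mem p)
    (hE.surfaceDiff_mem_tangent h.smooth h.mem p _), h.normal_unit, h.normal_orthogonal,
    h.isometric]
  ring

theorem inner_rotation_self (h : HasFundamentalData (productSpace κ) φ N D) (p : S)
    (u : TangentSpace I p) : ⟪D.J p u, u⟫_ℝ = 0 := by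
  have hE := OrientedModel.isRegular_productSpace κ
  rw [← h.isometric, h.rotation p u _ (hE.surfaceDiff_mem_tangent h.smooth h.mem p _),
    hE.vol_self]

variable {E : OrientedModel}

theorem xi_eq (h : HasFundamentalData E φ N D) (p : S) :
    E.ξ (φ p) = surfaceDiff I φ p (D.T p) + D.ν p • N p := by
  rw [h.tangent_part, sub_add_cancel]

variable {α : ℝ → S} {ℓ : ℝ}

theorem derivWithin_comp (h : HasFundamentalData E φ N D) (hℓ : 0 < ℓ)
    (hα : IsUnitSpeedCurve I α ℓ) {t : ℝ} (ht : t ∈ Icc 0 ℓ) :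
    derivWithin (φ ∘ α) (Icc 0 ℓ) t = surfaceDiff I φ (α t) (curveVelocity I α ℓ t) :=
  (hasDerivWithinAt_comp_curve hℓ h.smooth hα.smooth ht).derivWithin (uniqueDiffOn_Icc hℓ t ht)

/-- The second fundamental form in the direction of a curve is the normal part of its
acceleration. -/
theorem inner_shape_eq_accelInner (h : HasFundamentalData E φ N D) (hE : E.IsRegular) (hℓ : 0 < ℓ)
    (hα : IsUnitSpeedCurve I α ℓ) {t : ℝ} (ht : t ∈ Icc 0 ℓ) :
    ⟪D.A (α t) (curveVelocity I α ℓ t), curveVelocity I α ℓ t⟫_ℝ =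
      E.accelInner (φ ∘ α) (Icc 0 ℓ) t (N (α t)) := by
  have hγ := hasDerivWithinAt_comp_curve hℓ h.smooth hα.smooth ht
  have hN := hasDerivWithinAt_comp_curve hℓ h.normal_smooth hα.smooth ht
  have hv : HasDerivWithinAt (derivWithin (φ ∘ α) (Icc 0 ℓ)) _ (Icc 0 ℓ) t :=
    (((contDiffOn_comp_curve h.smooth hα.smooth).derivWithin (m := 1) (uniqueDiffOn_Icc hℓ)
      (by norm_cast)).differentiableOn (by simp) t ht).hasDerivWithinAt
  have hd := deriv_eq_zero_of_const_on (r := 0) hℓ ht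
    (hE.metric.hasDerivWithinAt (h.mem _) hγ hN hv) fun x hx => by
      rw [h.derivWithin_comp hℓ hα hx]
      exact h.normal_orthogonal _ _
  rw [h.shape]
  rw [h.derivWithin_comp hℓ hα ht] at hd
  rw [EmbeddedRiemannian.accelInner, h.derivWithin_comp hℓ hα ht]
  simp only [Function.comp_apply] at hd ⊢
  linarith

end HasFundamentalData

namespace AreConjugate

variable {κ H : ℝ} {φt Nt φ N : S → AmbientSpace} {D : SurfaceData I (S := S)}
  {ℓ : ℝ} {α : ℝ → S}

/-- Along a horizontal geodesic the tangential part of `ξ` is conormal to the curve. -/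
theorem T_eq (h : AreConjugate κ H φt Nt φ N D) (hℓ : 0 < ℓ) (hα : IsUnitSpeedCurve I α ℓ)
    (hγt : IsHorizontalGeodesic (Ekt (4 * H ^ 2 + κ) H) (φt ∘ α) ℓ) {t : ℝ} (ht : t ∈ Icc 0 ℓ) :
    D.T (α t) = ⟪D.T (α t), D.J (α t) (curveVelocity I α ℓ t)⟫_ℝ •
      D.J (α t) (curveVelocity I α ℓ t) := by
  have hE := OrientedModel.isRegular_Ekt (4 * H ^ 2 + κ) H
  have hdim : Module.finrank ℝ (TangentSpace I (α t)) = 2 :=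
    finrank_euclideanSpace_fin (𝕜 := ℝ) (n := 2)
  refine eq_smul_rotation_of_inner_eq_zero (E := TangentSpace I (α t)) hdim
    (h.target.inner_rotation (α t)) (h.target.inner_rotation_self (α t)) (hα.speed t ht) ?_
  have h1 := hγt.horizontal t ht
  rw [h.source.derivWithin_comp hℓ hα ht] at h1
  simp only [Function.comp_apply] at h1
  rw [h.source.xi_eq, hE.metric.add_right, hE.metric.smul_right, hE.metric.symm _ _ (Nt (α t)),
    h.source.normal_orthogonal, mul_zero, add_zero, h.source.isometric] at h1
  rw [real_inner_comm]
  exact h1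

theorem angle_eq (h : AreConjugate κ H φt Nt φ N D) (p : S) : D.ν p = (N p).2 := by
  have := h.target.angle p
  simpa [productSpace, modelSurface, SurfaceData.conjugate] using this

theorem vertical_eq (h : AreConjugate κ H φt Nt φ N D) (hℓ : 0 < ℓ) (hα : IsUnitSpeedCurve I α ℓ)
    (hγt : IsHorizontalGeodesic (Ekt (4 * H ^ 2 + κ) H) (φt ∘ α) ℓ) {t : ℝ} (ht : t ∈ Icc 0 ℓ) :
    ((0, 1) : AmbientSpace) = -⟪D.T (α t), D.J (α t) (curveVelocity I α ℓ t)⟫_ℝ •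
      surfaceDiff I φ (α t) (curveVelocity I α ℓ t) + (N (α t)).2 • N (α t) := by
  have h1 := h.target.xi_eq (α t)
  have h2 : (D.conjugate H).T (α t) = -⟪D.T (α t), D.J (α t) (curveVelocity I α ℓ t)⟫_ℝ •
      curveVelocity I α ℓ t := by
    change D.J (α t) (D.T (α t)) = _
    conv_lhs => rw [h.T_eq hℓ hα hγt ht]
    rw [map_smul]
    have := rotation_rotation (h.target.inner_rotation (α t))
      (h.target.inner_rotation_self (α t)) (curveVelocity I α ℓ t)
    change D.J (α t) (D.J (α t) _) = _ at this
    rw [this, smul_neg, neg_smul]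
  rw [h2, map_smul, show (D.conjugate H).ν (α t) = D.ν (α t) from rfl, h.angle_eq] at h1
  exact h1

theorem inner_T (h : AreConjugate κ H φt Nt φ N D) (hℓ : 0 < ℓ) (hα : IsUnitSpeedCurve I α ℓ)
    (hγt : IsHorizontalGeodesic (Ekt (4 * H ^ 2 + κ) H) (φt ∘ α) ℓ) {t : ℝ} (ht : t ∈ Icc 0 ℓ) :
    ⟪D.T (α t), D.J (α t) (curveVelocity I α ℓ t)⟫_ℝ =
      -(derivWithin (φ ∘ α) (Icc 0 ℓ) t).2 := by
  have hE := OrientedModel.isRegular_productSpace κ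
  have h1 := h.vertical_eq hℓ hα hγt ht
  have h2 : (productSpace κ).metric (φ (α t))
      (surfaceDiff I φ (α t) (curveVelocity I α ℓ t)) (0, 1) =
      (surfaceDiff I φ (α t) (curveVelocity I α ℓ t)).2 := by
    simp [metric_productSpace, modelForm]
  have h3 : ⟪curveVelocity I α ℓ t, curveVelocity I α ℓ t⟫_ℝ = 1 := by
    rw [real_inner_self_eq_norm_sq, curveVelocity, hα.speed t ht, one_pow]
  rw [h1, hE.metric.add_right, hE.metric.smul_right, hE.metric.smul_right,
    hE.metric.symm _ _ (N (α t)), h.target.normal_orthogonal, h.target.isometric, h3] at h2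
  rw [h.target.derivWithin_comp hℓ hα ht]
  linarith

variable [IsManifold I ∞ S]

/-- The curve `φ ∘ α` is a geodesic of the surface, since `φt ∘ α` is one and the two immersions
induce the same metric; it is a line of curvature since `⟨A e, J e⟩ = ⟨Ã e, e⟩` is the normal
curvature of the geodesic `φt ∘ α`. -/
theorem isAdaptedCurve (h : AreConjugate κ H φt Nt φ N D) (hℓ : 0 < ℓ)
    (hα : IsUnitSpeedCurve I α ℓ)
    (hγt : IsHorizontalGeodesic (Ekt (4 * H ^ 2 + κ) H) (φt ∘ α) ℓ) :
    IsAdaptedCurve κ ℓ (φ ∘ α) (N ∘ α) := by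
  have hE := OrientedModel.isRegular_productSpace κ
  have hEt := OrientedModel.isRegular_Ekt (4 * H ^ 2 + κ) H
  have hunit : ∀ t ∈ Icc 0 ℓ, ⟪curveVelocity I α ℓ t, curveVelocity I α ℓ t⟫_ℝ = 1 := by
    intro t ht
    rw [real_inner_self_eq_norm_sq, curveVelocity, hα.speed t ht, one_pow]
  refine ⟨contDiffOn_comp_curve h.target.smooth hα.smooth,
    contDiffOn_comp_curve h.target.normal_smooth hα.smooth, fun t _ => h.target.mem _,
    fun t ht => ?_, fun t _ => h.target.normal_mem _, fun t ht => ?_,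
    fun t _ => h.target.normal_unit _, fun t ht => ?_, fun t ht => ?_, fun t ht => ?_,
    fun t ht => ?_⟩
  · rw [h.target.derivWithin_comp hℓ hα ht]
    exact hE.surfaceDiff_mem_tangent h.target.smooth h.target.mem _ _
  · rw [h.target.derivWithin_comp hℓ hα ht]
    exact (h.target.isometric _ _ _).trans (hunit t ht)
  · rw [h.target.derivWithin_comp hℓ hα ht]
    exact h.target.normal_orthogonal _ _
  · have h1 := h.vertical_eq hℓ hα hγt ht
    rw [h.inner_T hℓ hα hγt ht, neg_neg, ← h.target.derivWithin_comp hℓ hα ht] at h1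
    exact h1
  · have h1 := accelInner_comp_curve_eq hE.metric hEt.metric h.target.smooth h.source.smooth
      h.target.mem h.source.mem
      (fun p u v => (h.target.isometric p u v).trans (h.source.isometric p u v).symm) hℓ hα.smooth
      ht (D.J (α t) (curveVelocity I α ℓ t))
    rw [hγt.geodesic.accel t ht _ (hEt.surfaceDiff_mem_tangent h.source.smooth h.source.mem _ _),
      accelInner_productSpace] at h1
    rw [h.target.derivWithin_comp hℓ hα ht]
    have h2 := h.target.surfaceDiff_rotation (α t) (curveVelocity I α ℓ t)
    change surfaceDiff I φ (α t) (D.J (α t) _) = _ at h2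
    rw [h2] at h1
    exact h1
  · have h1 := h.target.shape (α t) (curveVelocity I α ℓ t)
      (D.J (α t) (curveVelocity I α ℓ t))
    have h2 : ⟪(D.conjugate H).A (α t) (curveVelocity I α ℓ t),
        D.J (α t) (curveVelocity I α ℓ t)⟫_ℝ = 0 := by
      change ⟪D.J (α t) (D.A (α t) (curveVelocity I α ℓ t)) + H • curveVelocity I α ℓ t,
        D.J (α t) (curveVelocity I α ℓ t)⟫_ℝ = 0
      have h3 := inner_rotation_rotation (h.target.inner_rotation (α t))
        (h.target.inner_rotation_self (α t)) (D.A (α t) (curveVelocity I α ℓ t))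
        (curveVelocity I α ℓ t)
      have h4 := h.target.inner_rotation_self (α t) (curveVelocity I α ℓ t)
      change ⟪D.J (α t) _, D.J (α t) _⟫_ℝ = _ at h3
      change ⟪D.J (α t) _, _⟫_ℝ = _ at h4
      rw [inner_add_left, h3, real_inner_smul_left, real_inner_comm (D.J (α t) _), h4,
        h.source.inner_shape_eq_accelInner hEt hℓ hα ht,
        hγt.geodesic.accel t ht _ (h.source.normal_mem _)]
      ring
    have h5 := h.target.surfaceDiff_rotation (α t) (curveVelocity I α ℓ t)
    change surfaceDiff I φ (α t) (D.J (α t) _) = _ at h5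
    rw [h2, EmbeddedRiemannian.covInner, productSpace_christoffel, h5] at h1
    rw [h.target.derivWithin_comp hℓ hα ht,
      (hasDerivWithinAt_comp_curve hℓ h.target.normal_smooth hα.smooth ht).derivWithin
        (uniqueDiffOn_Icc hℓ t ht)]
    simp only [Function.comp_apply]
    linarith


/-- The angle is obtained by integrating the geodesic curvature of the conjugate curve. -/
theorem exists_isRotationAngle (h : AreConjugate κ H φt Nt φ N D) (hℓ : 0 < ℓ)
    (hα : IsUnitSpeedCurve I α ℓ)
    (hγt : IsHorizontalGeodesic (Ekt (4 * H ^ 2 + κ) H) (φt ∘ α) ℓ) :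
    ∃ (X : ℝ → AmbientSpace) (θ : ℝ → ℝ),
      IsRotationAngle (Ekt (4 * H ^ 2 + κ) H) (φt ∘ α) (Nt ∘ α) X ℓ θ := by
  have had := h.isAdaptedCurve hℓ hα hγt
  obtain ⟨θ, hθ, hcs⟩ := exists_smooth_angle hℓ (had.contDiffOn_curvature hℓ)
    (fun t ht => had.hasDerivWithinAt_cos hℓ ht) (fun t ht => had.hasDerivWithinAt_sin hℓ ht)
    (by rw [neg_sq]; exact had.sq_add_sq ⟨le_rfl, hℓ.le⟩)
  have hE := OrientedModel.isRegular_Ekt (4 * H ^ 2 + κ) H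
  set E := Ekt (4 * H ^ 2 + κ) H
  set η : ∀ t, AmbientSpace := fun t => surfaceDiff I φt (α t) (D.J (α t) (curveVelocity I α ℓ t))
  -- `X = γ' × ξ`, expanded in the frame formed by `γ'`, the conormal `η` and the normal
  set X : ℝ → AmbientSpace := fun t => Real.cos (θ t) • Nt (α t) - Real.sin (θ t) • η t
  have hξ : ∀ t ∈ Icc 0 ℓ,
      E.ξ (φt (α t)) = Real.cos (θ t) • η t + Real.sin (θ t) • Nt (α t) := by
    intro t ht
    have h1 := h.source.xi_eq (α t)
    rw [h.T_eq hℓ hα hγt ht, map_smul, h.inner_T hℓ hα hγt ht, h.angle_eq] at h1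
    rw [h1, ← (hcs t ht).1, ← (hcs t ht).2]
    rfl
  refine ⟨X, θ, hθ, fun t ht => ?_, fun t ht => ?_⟩
  · have hmem := h.source.mem (α t)
    have hv := h.source.derivWithin_comp hℓ hα ht
    have hvT := hE.surfaceDiff_mem_tangent h.source.smooth h.source.mem (α t)
      (curveVelocity I α ℓ t)
    have hηT : η t ∈ E.tangent (φt (α t)) :=
      hE.surfaceDiff_mem_tangent h.source.smooth h.source.mem (α t) _
    have hNT := h.source.normal_mem (α t)
    have hvv : E.metric (φt (α t)) (surfaceDiff I φt (α t) (curveVelocity I α ℓ t))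
        (surfaceDiff I φt (α t) (curveVelocity I α ℓ t)) = 1 := by
      rw [h.source.isometric, real_inner_self_eq_norm_sq, curveVelocity, hα.speed t ht, one_pow]
    have hηη : E.metric (φt (α t)) (η t) (η t) = 1 := by
      have h1 := h.target.inner_rotation (α t) (curveVelocity I α ℓ t)
      change ⟪D.J (α t) _, D.J (α t) _⟫_ℝ = _ at h1
      rw [h.source.isometric, h1, real_inner_self_eq_norm_sq, curveVelocity, hα.speed t ht,
        one_pow]
    have hvη : E.metric (φt (α t)) (surfaceDiff I φt (α t) (curveVelocity I α ℓ t)) (η t) = 0 := by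
      have h1 := h.target.inner_rotation_self (α t) (curveVelocity I α ℓ t)
      rw [hE.metric.symm, h.source.isometric]
      exact h1
    have hNN : E.metric (φt (α t)) (Nt (α t)) (Nt (α t)) = 1 := h.source.normal_unit (α t)
    have hvN : E.metric (φt (α t)) (surfaceDiff I φt (α t) (curveVelocity I α ℓ t))
        (Nt (α t)) = 0 :=
      (hE.metric.symm _ _ _).trans (h.source.normal_orthogonal (α t) _)
    have hNη : E.metric (φt (α t)) (Nt (α t)) (η t) = 0 := h.source.normal_orthogonal (α t) _
    have hηN := hNη
    rw [hE.metric.symm] at hηN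
    have hcs1 := Real.cos_sq_add_sin_sq (θ t)
    refine ⟨?_, hE.xi_mem _ hmem, ?_, ?_, hE.xi_unit _ hmem, ?_, ?_, ?_, ?_, ?_⟩
    · rw [hv]; exact hvT
    · exact hE.sub_mem hmem (hE.smul_mem _ hmem hNT) (hE.smul_mem _ hmem hηT)
    · rw [hv]; exact hvv
    · change E.metric (φt (α t)) (X t) (X t) = 1
      simp only [X, hE.metric.sub_left, hE.metric.sub_right, hE.metric.smul_left,
        hE.metric.smul_right, hNN, hNη, hηN, hηη]
      linear_combination hcs1
    · exact hγt.horizontal t ht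
    · rw [hv]
      change E.metric (φt (α t)) _ (X t) = 0
      simp only [X, hE.metric.sub_right, hE.metric.smul_right, hvN, hvη]
      ring
    · change E.metric (φt (α t)) (E.ξ (φt (α t))) (X t) = 0
      rw [hξ t ht]
      simp only [X, hE.metric.sub_right, hE.metric.add_left, hE.metric.smul_left,
        hE.metric.smul_right, hNN, hNη, hηN, hηη]
      ring
    · rw [hv]
      change 0 < E.vol (φt (α t)) _ (E.ξ (φt (α t))) (X t)
      have h2 := h.source.rotation (α t) (curveVelocity I α ℓ t) _ hηT
      rw [hξ t ht, hE.vol_rotated_frame, hcs1, one_mul, ← h2]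
      exact hηη.symm ▸ one_pos
  · change Nt (α t) = Real.cos (θ t) • X t + Real.sin (θ t) • E.ξ (φt (α t))
    rw [hξ t ht]
    calc Nt (α t) = (Real.cos (θ t) ^ 2 + Real.sin (θ t) ^ 2) • Nt (α t) := by
          rw [Real.cos_sq_add_sin_sq, one_smul]
      _ = _ := by simp only [X]; module

/-- The angle of rotation `θ` of the normal of `φt` is determined, up to multiples of `2π`, by the
vertical components of the velocity and of the normal of the conjugate curve. -/
theorem cos_sin_rotationAngle (h : AreConjugate κ H φt Nt φ N D) (hℓ : 0 < ℓ)
    (hα : IsUnitSpeedCurve I α ℓ)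
    (hγt : IsHorizontalGeodesic (Ekt (4 * H ^ 2 + κ) H) (φt ∘ α) ℓ) {X : ℝ → AmbientSpace}
    {θ : ℝ → ℝ} (hθ : IsRotationAngle (Ekt (4 * H ^ 2 + κ) H) (φt ∘ α) (Nt ∘ α) X ℓ θ) {t : ℝ}
    (ht : t ∈ Icc 0 ℓ) : -(derivWithin (φ ∘ α) (Icc 0 ℓ) t).2 = Real.cos (θ t) ∧
      (N (α t)).2 = Real.sin (θ t) := by
  have had := h.isAdaptedCurve hℓ hα hγt
  have hE := OrientedModel.isRegular_Ekt (4 * H ^ 2 + κ) H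
  set E := Ekt (4 * H ^ 2 + κ) H
  have hf := hθ.frame t ht
  have hN : Nt (α t) = Real.cos (θ t) • X t + Real.sin (θ t) • E.ξ (φt (α t)) := hθ.normal t ht
  have hsin : (N (α t)).2 = Real.sin (θ t) := by
    have h1 := hf.orthogonal₂₃
    have h2 := hf.unit₂
    simp only [Function.comp_apply] at h1 h2
    rw [← h.angle_eq, h.source.angle, hN, hE.metric.add_right, hE.metric.smul_right,
      hE.metric.smul_right, h1, h2]
    ring
  refine ⟨?_, hsin⟩
  have hvol := hf.positive
  rw [h.source.derivWithin_comp hℓ hα ht] at hvol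
  simp only [Function.comp_apply] at hvol
  have hξT := hE.xi_mem _ (h.source.mem (α t))
  -- `⟨ξ, N × γ'⟩ = cos θ vol (γ', ξ, X)`
  have hcos : -(derivWithin (φ ∘ α) (Icc 0 ℓ) t).2 = Real.cos (θ t) *
      E.vol (φt (α t)) (surfaceDiff I φt (α t) (curveVelocity I α ℓ t)) (E.ξ (φt (α t))) (X t) := by
    rw [← h.inner_T hℓ hα hγt ht, ← hE.vol_rotate _ _ _ _ _ (Real.sin (θ t)), ← hN,
      ← h.source.rotation (α t) _ _ hξT, h.source.xi_eq, hE.metric.add_right,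
      hE.metric.smul_right, hE.metric.symm _ _ (Nt (α t)), h.source.normal_orthogonal,
      h.source.isometric, real_inner_comm]
    ring
  have hsq : (-(derivWithin (φ ∘ α) (Icc 0 ℓ) t).2) ^ 2 = Real.cos (θ t) ^ 2 := by
    have h1 := had.sq_add_sq ht
    rw [Function.comp_apply, hsin] at h1
    linear_combination h1 - Real.cos_sq_add_sin_sq (θ t)
  rcases sq_eq_sq_iff_eq_or_eq_neg.1 hsq with h1 | h1
  · exact h1
  · have h2 : Real.cos (θ t) = 0 := by
      rw [h1] at hcos
      have : Real.cos (θ t) * (1 + E.vol (φt (α t))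
        (surfaceDiff I φt (α t) (curveVelocity I α ℓ t)) (E.ξ (φt (α t))) (X t)) = 0 := by
        linear_combination -hcos
      rcases mul_eq_zero.1 this with h3 | h3
      · exact h3
      · linarith
    rw [h1, h2, neg_zero]

end AreConjugate

end Conjugate

theorem mainTheorem11 {HS S : Type*} [TopologicalSpace HS] [TopologicalSpace S]
    (I : ModelWithCorners ℝ (EuclideanSpace ℝ (Fin 2)) HS) [ChartedSpace HS S] [IsManifold I ∞ S]
    [RiemannianBundle (fun p : S => TangentSpace I p)]
    (κ H : ℝ) (φt Nt φ N : S → AmbientSpace) (D : SurfaceData I (S := S))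
    (hconj : AreConjugate κ H φt Nt φ N D)
    (ℓ : ℝ) (hℓ : 0 < ℓ) (α : ℝ → S) (hα : IsUnitSpeedCurve I α ℓ)
    (hγt : IsHorizontalGeodesic (Ekt (4 * H ^ 2 + κ) H) (φt ∘ α) ℓ) :
    -- `γ = φ ∘ α` lies in a totally geodesic vertical plane that `φ` meets orthogonally
    ∃ c : ℝ → Fin 3 → ℝ, IsCompleteGeodesic κ c ∧
      (verticalPlane κ c).IsTotallyGeodesicIn (productSpace κ).toEmbeddedRiemannian ∧
      (∀ t ∈ Icc 0 ℓ, φ (α t) ∈ (verticalPlane κ c).carrier) ∧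
      (∀ t ∈ Icc 0 ℓ,
        MeetsOrthogonallyAt (productSpace κ) (verticalPlane κ c) (φ (α t)) (N (α t))) ∧
      -- (a) the speeds of the components of `γ = (β, z)`
      (∀ t ∈ Icc 0 ℓ,
        |derivWithin (fun r => (φ (α r)).2) (Icc 0 ℓ) t| = √(1 - D.ν (α t) ^ 2) ∧
        √((modelSurface κ).metric (φ (α t)).1
            (derivWithin (fun r => (φ (α r)).1) (Icc 0 ℓ) t)
            (derivWithin (fun r => (φ (α r)).1) (Icc 0 ℓ) t)) = |D.ν (α t)|) ∧
      (∀ t ∈ Icc 0 ℓ, D.ν (α t) ≠ 1 → D.ν (α t) ≠ -1 →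
        ∃ U ∈ 𝓝[Icc 0 ℓ] t, InjOn (fun r => (φ (α r)).2) U) ∧
      (∀ t ∈ Icc 0 ℓ, D.ν (α t) ≠ 0 →
        ∃ U ∈ 𝓝[Icc 0 ℓ] t, InjOn (fun r => (φ (α r)).1) U) ∧
      -- (b) the normal has an angle of rotation `θ` along `φt ∘ α`, and for each such `θ` the
      -- geodesic curvature of `γ` in the plane with respect to the conormal `N` is `θ'`
      (∃ (X : ℝ → AmbientSpace) (θ : ℝ → ℝ),
        IsRotationAngle (Ekt (4 * H ^ 2 + κ) H) (φt ∘ α) (Nt ∘ α) X ℓ θ) ∧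
      (∀ (X : ℝ → AmbientSpace) (θ : ℝ → ℝ),
        IsRotationAngle (Ekt (4 * H ^ 2 + κ) H) (φt ∘ α) (Nt ∘ α) X ℓ θ →
        ∀ t ∈ Icc 0 ℓ, N (α t) ∈ (verticalPlane κ c).tangent (φ (α t)) ∧
          (verticalPlane κ c).accelInner (φ ∘ α) (Icc 0 ℓ) t (N (α t)) =
            derivWithin θ (Icc 0 ℓ) t) := by
  have had := hconj.isAdaptedCurve hℓ hα hγt
  obtain ⟨c, a, hc, hplane⟩ := had.exists_geodesicWithNormal hℓ
  have hmem : ∀ t ∈ Icc 0 ℓ, φ (α t) ∈ (verticalPlane κ c).carrier := fun t ht => (hplane t ht).2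
  have hNa : ∀ t ∈ Icc 0 ℓ, modelForm κ (N (α t)).1 a = 0 := by
    intro t ht
    have h1 := IsAdaptedCurve.conormal_normal (κ := κ) (ℓ := ℓ) (γ := φ ∘ α) (N := N ∘ α) t
    rw [(hplane t ht).1, metric_productSpace, zero_mul, add_zero, modelForm_comm] at h1
    exact h1
  have hβ : ∀ t ∈ Icc 0 ℓ, derivWithin (fun r => (φ (α r)).1) (Icc 0 ℓ) t =
      (derivWithin (φ ∘ α) (Icc 0 ℓ) t).1 := fun t ht =>
    (hasDerivWithinAt_fst (had.hasDerivWithinAt ht)).derivWithin (uniqueDiffOn_Icc hℓ t ht)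
  have hz : ∀ t ∈ Icc 0 ℓ, derivWithin (fun r => (φ (α r)).2) (Icc 0 ℓ) t =
      (derivWithin (φ ∘ α) (Icc 0 ℓ) t).2 := fun t ht =>
    (hasDerivWithinAt_snd (had.hasDerivWithinAt ht)).derivWithin (uniqueDiffOn_Icc hℓ t ht)
  have hsq : ∀ t ∈ Icc 0 ℓ, (derivWithin (φ ∘ α) (Icc 0 ℓ) t).2 ^ 2 = 1 - D.ν (α t) ^ 2 := by
    intro t ht
    rw [hconj.angle_eq]
    exact eq_sub_of_add_eq (had.sq_add_sq ht)
  refine ⟨c, hc.geodesic, hc.isTotallyGeodesicIn, hmem,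
    fun t ht => hc.meetsOrthogonallyAt (hmem t ht) (hNa t ht), fun t ht => ⟨?_, ?_⟩,
    fun t ht h1 h2 => ?_, fun t ht h0 => ?_, hconj.exists_isRotationAngle hℓ hα hγt,
    fun X θ hθ t ht => ⟨?_, ?_⟩⟩
  · rw [hz t ht, ← hsq t ht, Real.sqrt_sq_eq_abs]
  · rw [hβ t ht, metric_modelSurface, ← Real.sqrt_sq_eq_abs]
    congr 1
    have h1 := had.velocity_unit t ht
    rw [metric_productSpace] at h1
    linear_combination h1 - hsq t ht
  · refine exists_injOn_of_derivWithin_ne_zero hℓ had.smooth.snd ht fun h0 => ?_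
    have h3 := hsq t ht
    have h4 : (derivWithin (φ ∘ α) (Icc 0 ℓ) t).2 = 0 := (hz t ht).symm.trans h0
    rw [h4] at h3
    rcases (sq_eq_sq_iff_eq_or_eq_neg (b := 1)).1
      (show D.ν (α t) ^ 2 = 1 ^ 2 by linarith) with h5 | h5
    exacts [h1 h5, h2 h5]
  · -- some coordinate of `β` has nonzero derivative, as `β' = 0` would give `ν = 0`
    have hne : (derivWithin (φ ∘ α) (Icc 0 ℓ) t).1 ≠ 0 := by
      intro h1
      have h2 := had.velocity_unit t ht
      rw [metric_productSpace, h1] at h2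
      have h3 : D.ν (α t) ^ 2 = 0 := by
        simp [modelForm] at h2
        linarith [hsq t ht]
      exact h0 (pow_eq_zero_iff two_ne_zero |>.1 h3)
    obtain ⟨i, hi⟩ := Function.ne_iff.1 hne
    have hd := hasDerivWithinAt_pi.1 (hasDerivWithinAt_fst (had.hasDerivWithinAt ht)) i
    obtain ⟨U, hU, hinj⟩ := exists_injOn_of_derivWithin_ne_zero hℓ
      (contDiffOn_pi.1 had.smooth.fst i) ht
      (by rw [hd.derivWithin (uniqueDiffOn_Icc hℓ t ht)]; exact hi)
    exact ⟨U, hU, fun x hx y hy hxy => hinj hx hy (congrFun hxy i)⟩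
  · obtain ⟨s, hs⟩ := (hplane t ht).2
    exact hc.mem_tangent hs (hconj.target.normal_mem _) (hNa t ht)
  · have e1 := had.hasDerivWithinAt_cos hℓ ht
    have e2 := had.hasDerivWithinAt_sin hℓ ht
    have hcs := fun x hx => hconj.cos_sin_rotationAngle hℓ hα hγt hθ (t := x) hx
    have hθd := (hθ.smooth.differentiableOn (by simp) t ht).hasDerivWithinAt
    -- differentiate `cos θ = -z'` and `sin θ = ν`
    have f1 := (uniqueDiffOn_Icc hℓ t ht).eq_deriv _ e1
      (hθd.cos.congr (fun x hx => (hcs x hx).1) (hcs t ht).1)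
    have f2 := (uniqueDiffOn_Icc hℓ t ht).eq_deriv _ e2
      (hθd.sin.congr (fun x hx => (hcs x hx).2) (hcs t ht).2)
    have f3 := Real.cos_sq_add_sin_sq (θ t)
    have h1 := accelInner_productSpace κ (φ ∘ α) (Icc 0 ℓ) t (N (α t))
    refine Eq.trans h1 ?_
    rw [(hcs t ht).1] at f2
    rw [Function.comp_apply, (hcs t ht).2] at f1
    simp only [Function.comp_apply] at f1 f2 ⊢
    linear_combination -Real.sin (θ t) * f1 + Real.cos (θ t) * f2
      + (derivWithin θ (Icc 0 ℓ) t - (productSpace κ).metric (φ (α t))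
        (derivWithin (derivWithin (φ ∘ α) (Icc 0 ℓ)) (Icc 0 ℓ) t) (N (α t))) * f3
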